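/- Let $1\le m\le n$ and let $\mathbb A_n^m$ be a commutative associative unital algebra over $\mathbb C$ of dimension $n$, with its Hausdorff vector space topology and with a basis $I_1,\dots,I_n$ such that: (1) $I_rI_s=0$ for $r\ne s$ and $I_r^2=I_r$, for $r,s\le m$; (2) for $r,s>m$, $I_rI_s=\sum_{k>\max\{r,s\}}\Upsilon_{r,k}^{s}I_k$ with $\Upsilon_{r,k}^s\in\mathbb C$; (3) for every $s>m$ there is exactly one $u_s\le m$ with $I_{u_s}I_s=I_s$ and $I_rI_s=0$ for all $r\le m$, $r\neq u_s$. For $u\le m$ let $f_u:\mathbb A_n^m\to\mathbb C$ be the linear functional with $f_u(I_u)=1$ and $f_u(I_k)=0$ for $k\ne u$. Let $e_1=1$, $e_2=\sum_r a_rI_r$, $e_3=\sum_r b_rI_r$ be linearly independent over $\mathbb R$, let $E_3=\{xe_1+ye_2+ze_3: x,y,z\in\mathbb R\}$, and suppose that $f_u(E_3)=\mathbb C$ for all $u=1,\dots,m$. Let $L_u\subset\mathbb R^3$ be the straight line of all $(x,y,z)$ with $x+ya_u+zb_u=0$. Let $\Omega\subset\mathbb R^3$ be a domain that is convex in the direction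 of each $L_u$ (it contains every segment parallel to $L_u$ with both end points in $\Omega$). Put $\Omega_\zeta=\{xe_1+ye_2+ze_3:(x,y,z)\in\Omega\}$, $D_u=f_u(\Omega_\zeta)$, and $\xi_u=f_u(\zeta)$ for $\zeta\in\Omega_\zeta$. Let $\Phi:\Omega_\zeta\to\mathbb A_n^m$ be monogenic, i.e. continuous and such that for every $\zeta\in\Omega_\zeta$ there is $\Phi'(\zeta)\in\mathbb A_n^m$ with $\lim_{\varepsilon\to0+}\varepsilon^{-1}(\Phi(\zeta+\varepsilon h)-\Phi(\zeta))=h\,\Phi'(\zeta)$ for all $h\in E_3$. Then there are holomorphic functions $F_u:D_u\to\mathbb C$ ($u=1,\dots,m$) and $G_s:D_{u_s}\to\mathbb C$ ($s=m+1,\dots,n$) such that, for every $\zeta=xe_1+ye_2+ze_3\in\Omega_\zeta$, $$\Phi(\zeta)=\sum_{u=1}^m I_u\,\frac1{2\pi i}\int_{\Gamma_u}F_u(t)(te_1-\zeta)^{-1}\,dt+\sum_{s=m+1}^n I_s\,\frac1{2\pi i}\int_{\Gamma_{u_s}}G_s(t)(te_1-\zeta)^{-1}\,dt$$ for all positively oriented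 closed Jordan rectifiable curves $\Gamma_1,\dots,\Gamma_m$ such that each $\Gamma_q$ lies together with its interior in $D_q$, surrounds $\xi_q$, and passes through no $\xi_\ell$ with $\ell\ne q$; such curves exist for every $\zeta\in\Omega_\zeta$. Equivalently, with the same functions, for every $\zeta=xe_1+ye_2+ze_3\in\Omega_\zeta$, $$\Phi(\zeta)=\sum_{u=1}^mF_u(\xi_u)I_u+\sum_{s=m+1}^n\sum_{k=2}^{s-m+1}\frac{Q_{k,s}}{(k-1)!}F_{u_s}^{(k-1)}(\xi_{u_s})I_s+\sum_{q=m+1}^nG_q(\xi_{u_q})I_q+\sum_{q=m+1}^n\sum_{s=m+1}^n\sum_{k=2}^{s-m+1}\frac{Q_{k,s}}{(k-1)!}G_q^{(k-1)}(\xi_{u_q})I_qI_s,$$ where $T_s=ya_s+zb_s$, $B_{r,s}=\sum_{p=m+1}^{s-1}T_p\Upsilon_{r,s}^{p}$, $Q_{2,s}=T_s$, and $Q_{k,s}=\sum_{r=m+1}^{s-1}Q_{k-1,r}B_{r,s}$ for $k\ge3$. -/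

import Mathlib

open Set Filter Topology

namespace MonogenicAlg

noncomputable section

/-! ### The algebra `𝔸_n^m`, its Cartan basis and its functionals -/

section Algebra

variable {A : Type*} [CommRing A] [Algebra ℂ A] {m d : ℕ}

/-- The multiplication rules of the algebra `𝔸_n^m`, `n = m + d`. The vectors `b (inl u)` are the
idempotents `I_1, …, I_m`, the vectors `b (inr s)` are the nilpotents `I_{m+1}, …, I_n` (in this
order), and `w s` is the index of the only idempotent that does not annihilate `b (inr s)`. -/
structure IsCartanBasis (b : Module.Basis (Fin m ⊕ Fin d) ℂ A) (w : Fin d → Fin m) : Prop where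
  idem_mul_idem : ∀ r s : Fin m,
    b (Sum.inl r) * b (Sum.inl s) = if r = s then b (Sum.inl r) else 0
  nil_mul_nil_left : ∀ (r s : Fin d) (u : Fin m),
    b.repr (b (Sum.inr r) * b (Sum.inr s)) (Sum.inl u) = 0
  nil_mul_nil_right : ∀ r s k : Fin d, k ≤ max r s →
    b.repr (b (Sum.inr r) * b (Sum.inr s)) (Sum.inr k) = 0
  idem_mul_nil : ∀ (r : Fin m) (s : Fin d),
    b (Sum.inl r) * b (Sum.inr s) = if r = w s then b (Sum.inr s) else 0

/-- The functional `f_u`: it is `1` at `I_u` and `0` at all other basis vectors. -/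
def functional (b : Module.Basis (Fin m ⊕ Fin d) ℂ A) (u : Fin m) : A →ₗ[ℂ] ℂ :=
  b.coord (Sum.inl u)

/-- The structure constant `Υ_{r,k}^s`: the coefficient of `I_k` in `I_r I_s`. -/
def structConst (b : Module.Basis (Fin m ⊕ Fin d) ℂ A) (r k s : Fin d) : ℂ :=
  b.repr (b (Sum.inr r) * b (Sum.inr s)) (Sum.inr k)

/-! ### The subspace `E_3`, the variable `ζ` and the sets attached to a domain of `ℝ³` -/

/-- The variable `ζ = x e_1 + y e_2 + z e_3` with `e_1 = 1`, for `p = (x, y, z)`. -/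
def zeta (e₂ e₃ : A) (p : Fin 3 → ℝ) : A :=
  p 0 • (1 : A) + p 1 • e₂ + p 2 • e₃

/-- The real linear span `E_3` of `1, e_2, e_3`. -/
def E3 (e₂ e₃ : A) : Set A := range (zeta e₂ e₃)

/-- The set `Ω_ζ` in `E_3` that corresponds to `Ω` in `ℝ³`. -/
def omegaZeta (e₂ e₃ : A) (Ω : Set (Fin 3 → ℝ)) : Set A := zeta e₂ e₃ '' Ω

/-- The set `D_u = f_u(Ω_ζ)` in the complex plane. -/
def planeDomain (b : Module.Basis (Fin m ⊕ Fin d) ℂ A) (e₂ e₃ : A) (Ω : Set (Fin 3 → ℝ))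
    (u : Fin m) : Set ℂ :=
  functional b u '' omegaZeta e₂ e₃ Ω

/-- The straight line `L_u` in `ℝ³`; here `a_u`, `b_u` are the coefficients of `I_u` in `e_2`,
`e_3`. -/
def lineL (b : Module.Basis (Fin m ⊕ Fin d) ℂ A) (e₂ e₃ : A) (u : Fin m) : Set (Fin 3 → ℝ) :=
  {p | p 0 + p 1 * (b.repr e₂ (Sum.inl u)).re + p 2 * (b.repr e₃ (Sum.inl u)).re = 0 ∧
    p 1 * (b.repr e₂ (Sum.inl u)).im + p 2 * (b.repr e₃ (Sum.inl u)).im = 0}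

/-- `Ω` is convex in the direction of the line `L` through the origin: it contains every segment
that is parallel to `L` and has both end points in `Ω`. -/
def ConvexInDirection (L Ω : Set (Fin 3 → ℝ)) : Prop :=
  ∀ p ∈ Ω, ∀ q ∈ Ω, q - p ∈ L → segment ℝ p q ⊆ Ω

/-- A function on `Ω_ζ` is monogenic if it is continuous and differentiable in the sense of
Gateaux at every point of `Ω_ζ`, the differential being the multiplication by an element of the
algebra. -/
def IsMonogenic [TopologicalSpace A] (e₂ e₃ : A) (Ω : Set (Fin 3 → ℝ)) (Φ : A → A) : Prop :=
  ContinuousOn Φ (omegaZeta e₂ e₃ Ω) ∧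
    ∀ ζ ∈ omegaZeta e₂ e₃ Ω, ∃ Φ' : A, ∀ h ∈ E3 e₂ e₃,
      Tendsto (fun ε : ℝ => ε⁻¹ • (Φ (ζ + ε • h) - Φ ζ)) (𝓝[>] 0) (𝓝 (h * Φ'))

/-! ### The coefficients of the expansion of the resolvent -/

/-- `T_s = y a_s + z b_s` for a nilpotent index `s`. -/
def coeffT (b : Module.Basis (Fin m ⊕ Fin d) ℂ A) (e₂ e₃ : A) (p : Fin 3 → ℝ) (s : Fin d) : ℂ :=
  (p 1 : ℂ) * b.repr e₂ (Sum.inr s) + (p 2 : ℂ) * b.repr e₃ (Sum.inr s)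

/-- `B_{r,s} = ∑_{q < s} T_q Υ_{r,s}^q`, the sum over the nilpotent indices `q < s`. -/
def coeffB (b : Module.Basis (Fin m ⊕ Fin d) ℂ A) (e₂ e₃ : A) (p : Fin 3 → ℝ) (r s : Fin d) : ℂ :=
  ∑ q ∈ Finset.univ.filter (fun q : Fin d => q < s),
    coeffT b e₂ e₃ p q * structConst b r s q

/-- `Q_{2,s} = T_s` and `Q_{k,s} = ∑_{r < s} Q_{k-1,r} B_{r,s}` for `k ≥ 3`, the sum over the
nilpotent indices `r < s`. With the position of `s` among the nilpotent indices counted from `0`,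
`Q_{k,s}` vanishes for `k > s + 2`; the values at `k = 0, 1` are not used. -/
def coeffQ (b : Module.Basis (Fin m ⊕ Fin d) ℂ A) (e₂ e₃ : A) (p : Fin 3 → ℝ) :
    ℕ → Fin d → ℂ
  | 0, _ => 0
  | 1, _ => 0
  | 2, s => coeffT b e₂ e₃ p s
  | k + 3, s => ∑ r ∈ Finset.univ.filter (fun r : Fin d => r < s),
      coeffQ b e₂ e₃ p (k + 2) r * coeffB b e₂ e₃ p r s

end Algebra

/-! ### Integrals along rectifiable curves -/

/-- A division `0 = x_0 ≤ x_1 ≤ … ≤ x_N = 1` of `[0, 1]` with tags `τ_i ∈ [x_i, x_{i+1}]`. -/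
structure TaggedDivision where
  N : ℕ
  x : ℕ → ℝ
  τ : ℕ → ℝ
  x_zero : x 0 = 0
  x_last : x N = 1
  x_le : ∀ i < N, x i ≤ x (i + 1)
  τ_mem : ∀ i < N, τ i ∈ Icc (x i) (x (i + 1))

/-- The filter of tagged divisions whose mesh tends to zero. -/
def meshFilter : Filter TaggedDivision :=
  ⨅ δ ∈ Ioi (0 : ℝ), 𝓟 {P | ∀ i < P.N, P.x (i + 1) - P.x i ≤ δ}

/-- The integral of `f` along the curve `γ : [0, 1] → ℂ` exists, as a limit of integral sums
`∑ (γ(x_{i+1}) - γ(x_i)) f(γ(τ_i))`, and is equal to `J`. -/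
def HasContourIntegral {A : Type*} [AddCommGroup A] [Module ℂ A] [TopologicalSpace A]
    (γ : ℝ → ℂ) (f : ℂ → A) (J : A) : Prop :=
  Tendsto (fun P : TaggedDivision =>
    ∑ i ∈ Finset.range P.N, (γ (P.x (i + 1)) - γ (P.x i)) • f (γ (P.τ i))) meshFilter (𝓝 J)

/-- The set of points of a curve. -/
def trace (γ : ℝ → ℂ) : Set ℂ := γ '' Icc 0 1

/-- The points surrounded by a curve: those in the bounded components of its complement. -/
def inside (γ : ℝ → ℂ) : Set ℂ :=
  {z | z ∉ trace γ ∧ Bornology.IsBounded (connectedComponentIn (trace γ)ᶜ z)}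

/-- Closed Jordan rectifiable curves, parametrized by `[0, 1]`. -/
structure IsRectifiableJordan (γ : ℝ → ℂ) : Prop where
  continuousOn : ContinuousOn γ (Icc 0 1)
  closed : γ 0 = γ 1
  injOn : InjOn γ (Ico 0 1)
  rectifiable : BoundedVariationOn γ (Icc 0 1)

/-- The curve winds once, counterclockwise, around each point that it surrounds. -/
def IsPositivelyOriented (γ : ℝ → ℂ) : Prop :=
  ∀ z ∈ inside γ, HasContourIntegral γ (fun t => (t - z)⁻¹) (2 * Real.pi * Complex.I)

/-- The curves `Γ_q` that are admitted in the integral representation at a point with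
`f_q(ζ) = ξ_q`: each `Γ_q` is a positively oriented closed Jordan rectifiable curve which lies,
together with its interior, in `D_q`, surrounds `ξ_q` and does not pass through any `ξ_l`,
`l ≠ q`. -/
structure IsAdmissible {m : ℕ} (D : Fin m → Set ℂ) (ξ : Fin m → ℂ) (Γ : Fin m → ℝ → ℂ) :
    Prop where
  jordan : ∀ q, IsRectifiableJordan (Γ q)
  oriented : ∀ q, IsPositivelyOriented (Γ q)
  trace_subset : ∀ q, trace (Γ q) ⊆ D q
  inside_subset : ∀ q, inside (Γ q) ⊆ D q
  surrounds : ∀ q, ξ q ∈ inside (Γ q)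
  avoids : ∀ q l, l ≠ q → ξ l ∉ trace (Γ q)

end

end MonogenicAlg

open MonogenicAlg

/-! Each `f_u` is a character of the algebra, and multiplication in the Cartan basis is triangular:
a product of nilpotent basis vectors involves only later ones. Hence the `I_u`-coordinate of a
monogenic `Φ` has derivative `f_u(h) c` in the direction `h`. It does not change along segments in
the kernel of `f_u`, which lie in `Ω` by convexity, so it is a function `F_u` of `ξ_u` alone
(`exists_differentiableOn_comp`).

`F_u` is continuous, and its one-sided directional derivatives are `h ↦ h c`. Holomorphy is not
immediate, because nothing makes these limits uniform in the direction;
`differentiableOn_of_hasGateauxDeriv` obtains it by a Baire category argument.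

Write `N` for the nilpotent part of `ζ`. The Taylor sum `∑ F^(k)(ξ) N^k I_i / k!`
(`principalExtension`) is monogenic and has leading term `F(ξ) I_i`. Subtracting these sums for all
`F_u` leaves a monogenic function with values in the span of the nilpotents. By triangularity its
first nilpotent coordinate is again a holomorphic function of one `ξ_u`; subtracting its extension
moves the remainder one level deeper, and after `d` levels nothing is left
(`exists_nil_decomposition`). Expanding the powers of `N` in the basis produces the coefficients
`Q_{k,s}`.

For the integral form, `(t - ζ)⁻¹ = ∑_u ∑_k N^k I_u / (t - ξ_u)^(k+1)`. Multiplication by `I_i`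
keeps a single `u`, and Cauchy's formula for derivatives turns the integral into the Taylor sum.
Since the curves are only rectifiable, Riemann–Stieltjes integration and a Cauchy theorem in Dixon's
form are developed for them (`hasStieltjes_cauchy`). -/

namespace MonogenicAlg

/-! ### Holomorphy from one-sided directional derivatives -/

open MeasureTheory Metric

/-- All one-sided directional derivatives of `f` at `z` exist and are given by the multiplication
by `c`. -/
def HasGateauxDeriv (f : ℂ → ℂ) (c z : ℂ) : Prop :=
  ∀ h : ℂ, Tendsto (fun ε : ℝ => ε⁻¹ • (f (z + ε • h) - f z)) (𝓝[>] 0) (𝓝 (h * c))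

/-- Mollification: the Lipschitz bound allows differentiation under the convolution integral, so the
mollified functions have complex-linear differentials, and a uniform limit of holomorphic functions
is holomorphic. -/
theorem differentiableOn_ball_of_lipschitzOn {f : ℂ → ℂ} (hf : Continuous f) {z₀ : ℂ} {R : ℝ}
    {K : NNReal} (hR : 0 < R) (hlip : LipschitzOnWith K f (ball z₀ (2 * R)))
    (hdir : ∀ z ∈ ball z₀ (2 * R), ∃ c, HasGateauxDeriv f c z) :
    DifferentiableOn ℂ f (ball z₀ R) := by
  classical
  choose! c hc using hdir
  -- Supports of radius at most `R`: at points of the ball of radius `R` the convolution sees `f`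
  -- only on the ball of radius `2 * R`.
  let φ : ℕ → ContDiffBump (0 : ℂ) := fun n =>
    ⟨R / (n + 1) / 2, R / (n + 1), by positivity, by
      have : 0 < R / ((n : ℝ) + 1) := by positivity
      linarith⟩
  have hout : ∀ n, (φ n).rOut ≤ R := fun n => by
    change R / ((n : ℝ) + 1) ≤ R
    exact div_le_self hR.le (by linarith [(Nat.cast_nonneg n : (0 : ℝ) ≤ n)])
  let g : ℕ → ℂ → ℂ := fun n =>
    convolution ((φ n).normed volume) f (ContinuousLinearMap.lsmul ℝ ℝ) volume
  have hsub : ∀ z ∈ ball z₀ R, ∀ t : ℂ, ‖t‖ < R → z - t ∈ ball z₀ (2 * R) := by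
    intro z hz t ht
    rw [mem_ball, dist_eq_norm] at hz ⊢
    calc ‖z - t - z₀‖ = ‖(z - z₀) - t‖ := by ring_nf
      _ ≤ ‖z - z₀‖ + ‖t‖ := norm_sub_le _ _
      _ < 2 * R := by linarith
  have hsupp : ∀ n, ∀ t : ℂ, R ≤ ‖t‖ → (φ n).normed volume t = 0 := by
    intro n t ht
    by_contra hne
    have hmem : t ∈ Function.support ((φ n).normed volume) := hne
    rw [ContDiffBump.support_normed_eq, mem_ball, dist_zero_right] at hmem
    linarith [hout n]
  have hgdiff : ∀ n, ContDiff ℝ 1 (g n) := fun n =>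
    (φ n).hasCompactSupport_normed.contDiff_convolution_left (n := 1) _ (φ n).contDiff_normed
      hf.locallyIntegrable
  have hgC : ∀ n, DifferentiableOn ℂ (g n) (ball z₀ R) := by
    intro n z hz
    have hdiff : DifferentiableAt ℝ (g n) z := (hgdiff n).differentiable (by norm_num) z
    set L := fderiv ℝ (g n) z with hL
    have hφi : Integrable ((φ n).normed volume) (volume : Measure ℂ) := (φ n).integrable_normed
    -- As `g n` is already smooth, a one-sided limit determines its differential. Dominated
    -- convergence applies because the difference quotients of `f` are bounded by `K * ‖h‖`.
    have key : ∀ h : ℂ, L h = ∫ t, (φ n).normed volume t • (h * c (z - t)) := by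
      intro h
      have h1 : Tendsto (fun ε : ℝ => ε⁻¹ • (g n (z + ε • h) - g n z)) (𝓝[>] 0) (𝓝 (L h)) := by
        have hline : HasDerivAt (fun ε : ℝ => g n (z + ε • h)) (L h) 0 := by
          have hfd : HasFDerivAt (g n) L (z + (0 : ℝ) • h) := by
            simpa using hdiff.hasFDerivAt
          have hin : HasDerivAt (fun ε : ℝ => z + ε • h) h 0 := by
            simpa using ((hasDerivAt_id (0 : ℝ)).smul_const h).const_add z
          exact hfd.comp_hasDerivAt (0 : ℝ) hin
        have := hline.tendsto_slope_zero_right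
        simpa using this
      have h2 : Tendsto (fun ε : ℝ => ∫ t, (φ n).normed volume t •
          (ε⁻¹ • (f (z - t + ε • h) - f (z - t)))) (𝓝[>] 0)
          (𝓝 (∫ t, (φ n).normed volume t • (h * c (z - t)))) := by
        refine tendsto_integral_filter_of_dominated_convergence
          (fun t => (φ n).normed volume t * (K * ‖h‖)) ?_ ?_ (hφi.mul_const _) ?_
        · refine Eventually.of_forall fun ε => Continuous.aestronglyMeasurable ?_
          exact (φ n).continuous_normed.smul (by fun_prop)
        · have hsmall : ∀ᶠ ε : ℝ in 𝓝[>] 0, z + ε • h ∈ ball z₀ R := by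
            have hcont : Tendsto (fun ε : ℝ => z + ε • h) (𝓝[>] 0) (𝓝 z) := by
              have : Continuous fun ε : ℝ => z + ε • h := by fun_prop
              simpa using (this.tendsto 0).mono_left nhdsWithin_le_nhds
            exact hcont (isOpen_ball.mem_nhds hz)
          filter_upwards [hsmall, self_mem_nhdsWithin] with ε hε hpos
          refine Eventually.of_forall fun t => ?_
          by_cases ht : ‖t‖ < R
          · have hd := hlip.dist_le_mul _ (hsub _ hε t ht) _ (hsub _ hz t ht)
            rw [dist_eq_norm, dist_eq_norm] at hd
            have e1 : z + ε • h - t = z - t + ε • h := by ring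
            have e2 : z + ε • h - t - (z - t) = ε • h := by ring
            rw [e2, e1, norm_smul, Real.norm_of_nonneg (le_of_lt hpos)] at hd
            rw [norm_smul, norm_smul, Real.norm_of_nonneg ((φ n).nonneg_normed t),
              norm_inv, Real.norm_of_nonneg (le_of_lt hpos)]
            refine mul_le_mul_of_nonneg_left ?_ ((φ n).nonneg_normed t)
            have hpos' : (0 : ℝ) < ε := hpos
            rw [inv_mul_le_iff₀ hpos']
            linarith
          · simp [hsupp n t (not_lt.mp ht)]
        · refine Eventually.of_forall fun t => ?_
          by_cases ht : ‖t‖ < R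
          · exact (hc _ (hsub _ hz t ht) h).const_smul _
          · simp [hsupp n t (not_lt.mp ht)]
      refine tendsto_nhds_unique h1 (h2.congr fun ε => ?_)
      have hint : ∀ y : ℂ, Integrable (fun t => (φ n).normed volume t • f (y - t)) := by
        intro y
        refine Continuous.integrable_of_hasCompactSupport ?_ ?_
        · exact (φ n).continuous_normed.smul (by fun_prop)
        · exact (φ n).hasCompactSupport_normed.smul_right
      change _ = ε⁻¹ • ((∫ t, (φ n).normed volume t • f (z + ε • h - t)) -
        ∫ t, (φ n).normed volume t • f (z - t))
      rw [← integral_sub (hint _) (hint _), ← integral_smul]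
      congr 1
      ext t
      rw [← smul_sub, smul_comm]
      congr 4
      ring
    have hlin : ∀ h : ℂ, L h = h * L 1 := by
      intro h
      rw [key h, key 1, ← integral_const_mul]
      congr 1
      ext t
      simp only [Complex.real_smul]
      ring
    refine (hasFDerivAt_of_restrictScalars ℝ (f' := (ContinuousLinearMap.toSpanSingleton ℂ (L 1)))
      hdiff.hasFDerivAt ?_).differentiableAt.differentiableWithinAt
    ext h
    simpa [hL] using (hlin h).symm
  have hlim : TendstoLocallyUniformlyOn g f atTop (ball z₀ R) := by
    refine TendstoUniformlyOn.tendstoLocallyUniformlyOn ?_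
    rw [Metric.tendstoUniformlyOn_iff]
    intro ε hε
    have ht : Tendsto (fun n : ℕ => (K : ℝ) * (R / ((n : ℝ) + 1))) atTop (𝓝 0) := by
      have := (tendsto_const_div_atTop_nhds_zero_nat R).comp (tendsto_add_atTop_nat 1)
      simpa [Function.comp_def] using this.const_mul (K : ℝ)
    filter_upwards [ht.eventually (gt_mem_nhds hε)] with n hn z hz
    rw [dist_comm]
    refine lt_of_le_of_lt (ContDiffBump.dist_normed_convolution_le
      hf.aestronglyMeasurable fun x hx => ?_) hn
    rw [mem_ball] at hx
    have hx2 : x ∈ ball z₀ (2 * R) := by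
      rw [mem_ball] at hz ⊢
      linarith [dist_triangle x z z₀, hout n]
    have hz2 : z ∈ ball z₀ (2 * R) := by
      rw [mem_ball] at hz ⊢
      linarith
    exact (hlip.dist_le_mul _ hx2 _ hz2).trans
      (mul_le_mul_of_nonneg_left (le_of_lt hx) K.coe_nonneg)
  exact hlim.differentiableOn (Eventually.of_forall hgC) isOpen_ball

/-- A uniform Lipschitz bound on a cone with vertex at any point of `F` gives a Lipschitz bound
on `F`. -/
theorem norm_sub_le_of_cone {f : ℂ → ℂ} {F : Set ℂ} {h₀ : ℂ} {η τ n : ℝ}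
    (hη : 0 < η)
    (hcone : ∀ e ∈ F, ∀ h ∈ ball h₀ η, ∀ t ∈ Ioc 0 τ, ‖f (e + t • h) - f e‖ ≤ n * t)
    {e e' : ℂ} (he : e ∈ F) (he' : e' ∈ F) (hd : 2 / η * ‖e - e'‖ ≤ τ) :
    ‖f e - f e'‖ ≤ 4 * n / η * ‖e - e'‖ := by
  rcases eq_or_ne e e' with rfl | hne
  · simp
  have hs : 0 < ‖e - e'‖ := norm_pos_iff.mpr (sub_ne_zero.mpr hne)
  -- With this `T` the direction from `e'` to `e + T • h₀` differs from `h₀` by `η / 2`, so the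
  -- cones with vertices `e` and `e'` share that point.
  set T : ℝ := 2 / η * ‖e - e'‖ with hT
  have hTpos : 0 < T := by positivity
  have h1 := hcone e he h₀ (mem_ball_self hη) T ⟨hTpos, hd⟩
  have hmem : h₀ + T⁻¹ • (e - e') ∈ ball h₀ η := by
    rw [mem_ball, dist_eq_norm, add_sub_cancel_left, norm_smul, norm_inv,
      Real.norm_of_nonneg hTpos.le, hT]
    have : (2 / η * ‖e - e'‖)⁻¹ * ‖e - e'‖ = η / 2 := by
      field_simp
    rw [this]
    linarith
  have h2 := hcone e' he' _ hmem T ⟨hTpos, hd⟩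
  have hp : e' + T • (h₀ + T⁻¹ • (e - e')) = e + T • h₀ := by
    rw [smul_add, smul_inv_smul₀ hTpos.ne']
    ring
  rw [hp] at h2
  calc ‖f e - f e'‖ = ‖(f (e + T • h₀) - f e') - (f (e + T • h₀) - f e)‖ := by ring_nf
    _ ≤ n * T + n * T := (norm_sub_le _ _).trans (add_le_add h2 h1)
    _ = 4 * n / η * ‖e - e'‖ := by rw [hT]; ring

/-- A function holomorphic off a relatively closed set `F` that satisfies a Lipschitz bound on `F`
and on a cone with vertex `e ∈ F` satisfies a Lipschitz bound at `e`. -/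
theorem norm_sub_le_of_cone_of_differentiableAt {f : ℂ → ℂ} (hf : Continuous f) {D F : Set ℂ}
    (hDF : IsOpen (D \ F)) (hdiff : ∀ z ∈ D \ F, DifferentiableAt ℂ f z)
    {h₀ : ℂ} {η τ n C M r : ℝ} (hη : 0 < η) (hτ : 0 < τ) (hr : 0 < r) (hn : 0 ≤ n) (hC : 0 ≤ C)
    (hM : 0 ≤ M) {e : ℂ} (heF : e ∈ F)
    (hcone : ∀ h ∈ ball h₀ η, ∀ t ∈ Ioc 0 τ, ‖f (e + t • h) - f e‖ ≤ n * t)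
    (hball : closedBall e r ⊆ D)
    (hbdd : ∀ z ∈ closedBall e r, ‖f z - f e‖ ≤ M)
    (hlip : ∀ z ∈ closedBall e r, z ∈ F → ‖f z - f e‖ ≤ C * ‖z - e‖) {z : ℂ} (hz : z ∈ ball e r) :
    ‖f z - f e‖ ≤ (C * (1 + 2 * ‖h₀‖ / η) + 2 * n / η + 2 * M / r) * ‖z - e‖ := by
  set B := C * (1 + 2 * ‖h₀‖ / η) + 2 * n / η + 2 * M / r with hB
  have hb1 : 0 ≤ C * (1 + 2 * ‖h₀‖ / η) := by positivity
  have hb2 : 0 ≤ 2 * n / η := by positivity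
  have hb3 : 0 ≤ 2 * M / r := by positivity
  by_cases hzF : z ∈ F
  · refine (hlip z (ball_subset_closedBall hz) hzF).trans ?_
    refine mul_le_mul_of_nonneg_right ?_ (norm_nonneg _)
    have : C ≤ C * (1 + 2 * ‖h₀‖ / η) := le_mul_of_one_le_right hC (by
      have : 0 ≤ 2 * ‖h₀‖ / η := by positivity
      linarith)
    linarith
  have hze : z ≠ e := fun h => hzF (h ▸ heF)
  have hzpos : 0 < ‖z - e‖ := norm_pos_iff.mpr (sub_ne_zero.mpr hze)
  -- Maximum principle for `(f y - f e) / (y - e - δ h₀)`: the pole is moved from `e` into the cone,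
  -- and a disc of radius `η δ / 2` around it is removed. The three summands of `B` bound the
  -- quotient on the three kinds of boundary points: in `F`, on the small circle (inside the cone),
  -- and on the outer circle. Finally `δ` tends to zero.
  have main : ∀ δ : ℝ, 0 < δ → δ ≤ τ → δ * ‖h₀‖ ≤ r / 2 → η * δ / 2 < ‖z - e - δ • h₀‖ →
      ‖f z - f e‖ ≤ B * ‖z - e - δ • h₀‖ := by
    intro δ hδ hδτ hδr hδz
    let U : Set ℂ := (ball e r ∩ (D \ F)) ∩ {y | η * δ / 2 < ‖y - e - δ • h₀‖}
    have hUo : IsOpen U := (isOpen_ball.inter hDF).inter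
      (isOpen_lt continuous_const (by fun_prop))
    have hcl : ∀ y ∈ closure U, y ∈ closedBall e r ∧ η * δ / 2 ≤ ‖y - e - δ • h₀‖ := by
      intro y hy
      constructor
      · exact closure_ball_subset_closedBall (closure_mono (fun x hx => hx.1.1) hy)
      · have : U ⊆ {y | η * δ / 2 ≤ ‖y - e - δ • h₀‖} := fun x hx => le_of_lt (mem_ofPred_eq ▸ hx.2 : _ < _)
        exact closure_minimal this (isClosed_le continuous_const (by fun_prop)) hy
    have hne : ∀ y : ℂ, η * δ / 2 ≤ ‖y - e - δ • h₀‖ → y - e - δ • h₀ ≠ 0 := by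
      intro y hy h0
      rw [h0, norm_zero] at hy
      have : 0 < η * δ / 2 := by positivity
      linarith
    have hd : DiffContOnCl ℂ (fun y => (f y - f e) / (y - e - δ • h₀)) U := by
      constructor
      · intro y hy
        refine (DifferentiableAt.div ((hdiff y hy.1.2).sub_const _) (by fun_prop)
          (hne y hy.2.le)).differentiableWithinAt
      · refine ContinuousOn.div (by fun_prop) (by fun_prop) fun y hy => hne y (hcl y hy).2
    have hzU : z ∈ U := ⟨⟨hz, hball (ball_subset_closedBall hz), hzF⟩, hδz⟩
    have hq := Complex.norm_le_of_forall_mem_frontier_norm_le (C := B)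
      (isBounded_ball.subset fun x hx => hx.1.1) hd ?_ (subset_closure hzU)
    · rw [norm_div, div_le_iff₀ (norm_pos_iff.mpr (hne z hδz.le))] at hq
      exact hq
    · intro y hy
      obtain ⟨hy1, hy2⟩ := hcl y (frontier_subset_closure hy)
      have hyU : y ∉ U := by
        rw [hUo.frontier_eq] at hy
        exact hy.2
      have hpos : 0 < ‖y - e - δ • h₀‖ := norm_pos_iff.mpr (hne y hy2)
      rw [norm_div, div_le_iff₀ hpos]
      by_cases hyF : y ∈ F
      · refine (hlip y hy1 hyF).trans ?_
        have h1 : ‖y - e‖ ≤ (1 + 2 * ‖h₀‖ / η) * ‖y - e - δ • h₀‖ := by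
          have ha : ‖y - e‖ ≤ ‖y - e - δ • h₀‖ + δ * ‖h₀‖ := by
            calc ‖y - e‖ = ‖(y - e - δ • h₀) + δ • h₀‖ := by rw [sub_add_cancel]
              _ ≤ _ := (norm_add_le _ _).trans (by
                rw [norm_smul, Real.norm_of_nonneg hδ.le])
          have hb : δ * ‖h₀‖ = 2 * ‖h₀‖ / η * (η * δ / 2) := by field_simp
          have hc : 2 * ‖h₀‖ / η * (η * δ / 2) ≤ 2 * ‖h₀‖ / η * ‖y - e - δ • h₀‖ :=
            mul_le_mul_of_nonneg_left hy2 (by positivity)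
          linarith
        calc C * ‖y - e‖ ≤ C * ((1 + 2 * ‖h₀‖ / η) * ‖y - e - δ • h₀‖) :=
              mul_le_mul_of_nonneg_left h1 hC
          _ = C * (1 + 2 * ‖h₀‖ / η) * ‖y - e - δ • h₀‖ := by ring
          _ ≤ B * ‖y - e - δ • h₀‖ := mul_le_mul_of_nonneg_right (by linarith) hpos.le
      · by_cases hyr : y ∈ ball e r
        · have hyδ : ‖y - e - δ • h₀‖ ≤ η * δ / 2 := by
            by_contra hlt
            exact hyU ⟨⟨hyr, hball hy1, hyF⟩, not_le.mp hlt⟩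
          have hmem : δ⁻¹ • (y - e) ∈ ball h₀ η := by
            rw [mem_ball, dist_eq_norm]
            have : δ⁻¹ • (y - e) - h₀ = δ⁻¹ • (y - e - δ • h₀) := by
              rw [smul_sub _ (y - e), inv_smul_smul₀ hδ.ne']
            rw [this, norm_smul, norm_inv, Real.norm_of_nonneg hδ.le, inv_mul_lt_iff₀ hδ]
            nlinarith [mul_pos hη hδ]
          have := hcone _ hmem δ ⟨hδ, hδτ⟩
          rw [smul_inv_smul₀ hδ.ne', add_sub_cancel] at this
          refine this.trans ?_
          calc n * δ = 2 * n / η * (η * δ / 2) := by field_simp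
            _ ≤ 2 * n / η * ‖y - e - δ • h₀‖ := mul_le_mul_of_nonneg_left hy2 hb2
            _ ≤ B * ‖y - e - δ • h₀‖ := mul_le_mul_of_nonneg_right (by linarith) hpos.le
        · refine (hbdd y hy1).trans ?_
          have hge : r / 2 ≤ ‖y - e - δ • h₀‖ := by
            have h1 : r ≤ ‖y - e‖ := by
              rw [mem_ball, dist_eq_norm, not_lt] at hyr
              exact hyr
            have h2 := norm_sub_norm_le (y - e) (δ • h₀)
            rw [norm_smul, Real.norm_of_nonneg hδ.le] at h2
            linarith
          calc M = 2 * M / r * (r / 2) := by field_simp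
            _ ≤ 2 * M / r * ‖y - e - δ • h₀‖ := mul_le_mul_of_nonneg_left hge hb3
            _ ≤ B * ‖y - e - δ • h₀‖ := mul_le_mul_of_nonneg_right (by linarith) hpos.le
  have hc1 : Tendsto (fun δ : ℝ => ‖z - e - δ • h₀‖) (𝓝[>] 0) (𝓝 ‖z - e‖) := by
    have : Continuous fun δ : ℝ => ‖z - e - δ • h₀‖ := by fun_prop
    simpa using (this.tendsto 0).mono_left nhdsWithin_le_nhds
  have hc2 : Tendsto (fun δ : ℝ => δ * ‖h₀‖) (𝓝[>] 0) (𝓝 0) := by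
    have : Continuous fun δ : ℝ => δ * ‖h₀‖ := by fun_prop
    simpa using (this.tendsto 0).mono_left nhdsWithin_le_nhds
  have hc3 : Tendsto (fun δ : ℝ => η * δ / 2) (𝓝[>] 0) (𝓝 0) := by
    have : Continuous fun δ : ℝ => η * δ / 2 := by fun_prop
    simpa using (this.tendsto 0).mono_left nhdsWithin_le_nhds
  refine ge_of_tendsto (hc1.const_mul B) ?_
  filter_upwards [self_mem_nhdsWithin, Ioc_mem_nhdsGT hτ,
    hc2.eventually (ge_mem_nhds (half_pos hr)), hc3.eventually_lt hc1 hzpos] with δ h1 h2 h3 h4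
  exact main δ h1 h2.2 h3 h4

/-- A function holomorphic off a relatively closed set `F` that is Lipschitz at the points of `F`,
uniformly, is Lipschitz. -/
theorem lipschitzOnWith_of_norm_sub_le {f : ℂ → ℂ} {D F : Set ℂ}
    (hdiff : ∀ z ∈ D \ F, DifferentiableAt ℂ f z) {e₀ : ℂ} {r C : ℝ} (hC : 0 ≤ C) (he₀ : e₀ ∈ F)
    (hball : ball e₀ (2 * r) ⊆ D)
    (hlip : ∀ e ∈ F, e ∈ ball e₀ r → ∀ z ∈ ball e r, ‖f z - f e‖ ≤ C * ‖z - e‖) :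
    LipschitzOnWith (Real.toNNReal (6 * C + 1)) f (ball e₀ (r / 8)) := by
  refine LipschitzOnWith.of_dist_le_mul fun z hz w hw => ?_
  rw [Real.coe_toNNReal _ (by positivity)]
  have hzr : dist z e₀ < r / 8 := hz
  have hwr : dist w e₀ < r / 8 := hw
  have hlip' : ∀ e ∈ F, e ∈ ball e₀ r → ∀ z ∈ ball e r, dist (f z) (f e) ≤ C * dist z e := by
    simpa only [dist_eq_norm] using hlip
  have hzw := dist_triangle_right z w e₀
  have hd0 : 0 ≤ dist z w := dist_nonneg
  set d := infDist z F with hd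
  have hdle : d ≤ dist z e₀ := infDist_le_dist_of_mem he₀
  -- If `F` is near compared with `dist z w`, pass through a point of `F`, at a cost of `5 * C`.
  -- Otherwise `f` is holomorphic on the ball of radius `d` about `z`, and the Schwarz lemma gives
  -- the same constant.
  rcases le_or_gt d (dist z w) with hle | hlt
  · rcases eq_or_ne z w with rfl | hne
    · simp
    have hpos : 0 < dist z w := dist_pos.mpr hne
    obtain ⟨e, heF, hez⟩ := (infDist_lt_iff ⟨e₀, he₀⟩).mp
      (show infDist z F < 2 * dist z w by linarith)
    have h1 := dist_triangle_left e e₀ z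
    have h2 := dist_triangle_left w e z
    have heb : e ∈ ball e₀ r := by rw [mem_ball]; linarith
    have a1 := hlip' e heF heb z (by rw [mem_ball]; linarith)
    have a2 := hlip' e heF heb w (by rw [mem_ball]; linarith)
    have a3 := dist_triangle_right (f z) (f w) (f e)
    nlinarith
  · have hdpos : 0 < d := lt_of_le_of_lt hd0 hlt
    obtain ⟨e, heF, hez⟩ := (infDist_lt_iff ⟨e₀, he₀⟩).mp
      (show infDist z F < 2 * d by linarith)
    have h1 := dist_triangle_left e e₀ z
    have heb : e ∈ ball e₀ r := by rw [mem_ball]; linarith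
    have hsub : ball z d ⊆ D \ F := by
      intro y hy
      refine ⟨hball ?_, fun hyF => ?_⟩
      · rw [mem_ball] at hy ⊢
        linarith [dist_triangle y z e₀]
      · have := infDist_le_dist_of_mem (x := z) hyF
        rw [mem_ball, dist_comm] at hy
        linarith
    have hmaps : MapsTo f (ball z d) (closedBall (f z) (5 * C * d)) := by
      intro y hy
      rw [mem_ball] at hy
      rw [mem_closedBall]
      have h2 := dist_triangle y z e
      have a1 := hlip' e heF heb z (by rw [mem_ball]; linarith)
      have a2 := hlip' e heF heb y (by rw [mem_ball]; linarith)
      have a3 := dist_triangle_right (f y) (f z) (f e)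
      nlinarith
    have := Complex.dist_le_div_mul_dist_of_mapsTo_ball (z := w)
      (fun y hy => (hdiff y (hsub hy)).differentiableWithinAt) hmaps
      (by rw [mem_ball, dist_comm]; exact hlt)
    rw [mul_div_assoc, div_self hdpos.ne', mul_one, dist_comm (f w), dist_comm w] at this
    nlinarith

/-- If the set `F` of points near which `f` is not holomorphic were nonempty, Baire's theorem would
give a portion of `F` with one difference quotient bound on a whole cone of directions. That makes
`f` Lipschitz near a point of `F`, hence holomorphic there, a contradiction. -/
theorem differentiableOn_of_hasGateauxDeriv_of_continuous {f : ℂ → ℂ} (hf : Continuous f)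
    {D : Set ℂ} (hD : IsOpen D) (hdir : ∀ z ∈ D, ∃ c, HasGateauxDeriv f c z) :
    DifferentiableOn ℂ f D := by
  set U : Set ℂ := {z ∈ D | ∀ᶠ w in 𝓝 z, DifferentiableAt ℂ f w} with hU
  have hUo : IsOpen U := hD.inter isOpen_setOfPred_eventually_nhds
  by_cases hFe : (D \ U).Nonempty
  swap
  · rw [Set.not_nonempty_iff_eq_empty, sdiff_eq_empty] at hFe
    intro z hz
    exact (hFe hz).2.self_of_nhds.differentiableWithinAt
  exfalso
  set F := D \ U with hF
  have hDF : D \ F = U := by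
    rw [hF, sdiff_sdiff_right_self]
    exact inter_eq_self_of_subset_right fun z hz => hz.1
  have hDFo : IsOpen (D \ F) := hDF ▸ hUo
  have hdiff : ∀ z ∈ D \ F, DifferentiableAt ℂ f z := by
    rw [hDF]
    exact fun z hz => hz.2.self_of_nhds
  have hlc : IsLocallyClosed F := hD.isLocallyClosed.inter hUo.isClosed_compl.isLocallyClosed
  have : LocallyCompactSpace F := hlc.locallyCompactSpace
  have : Nonempty F := hFe.to_subtype
  -- The category argument runs over pairs (point, direction): an interior point of some `X n`
  -- yields a neighbourhood in `F` and a full disc of directions at once. `F` is locally closed,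
  -- hence locally compact, so `F × ℂ` is a Baire space.
  let X : ℕ → Set (F × ℂ) := fun n =>
    {x | ∀ t ∈ Ioc (0 : ℝ) (1 / ((n : ℝ) + 1)), ‖f (x.1 + t • x.2) - f x.1‖ ≤ n * t}
  have hXc : ∀ n, IsClosed (X n) := by
    intro n
    have : X n = ⋂ t ∈ Ioc (0 : ℝ) (1 / ((n : ℝ) + 1)),
        {x : F × ℂ | ‖f (x.1 + t • x.2) - f x.1‖ ≤ n * t} := by
      ext x
      simp [X]
    rw [this]
    refine isClosed_biInter fun t _ => isClosed_le ?_ continuous_const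
    fun_prop
  have hXu : ⋃ n, X n = univ := by
    refine eq_univ_of_forall fun x => mem_iUnion.mpr ?_
    obtain ⟨c, hc⟩ := hdir x.1 x.1.2.1
    have h1 := (hc x.2).norm.eventually (gt_mem_nhds (lt_add_one ‖x.2 * c‖))
    obtain ⟨δ, hδ, hδ'⟩ := mem_nhdsGT_iff_exists_Ioo_subset.mp h1
    obtain ⟨n, hn⟩ := exists_nat_gt (max (1 / δ) (‖x.2 * c‖ + 1))
    refine ⟨n, fun t ht => ?_⟩
    have hδpos : (0 : ℝ) < δ := hδ
    have hn1 : 1 / δ < n := (le_max_left _ _).trans_lt hn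
    have hn2 : ‖x.2 * c‖ + 1 < n := (le_max_right _ _).trans_lt hn
    have htδ : t < δ := by
      refine ht.2.trans_lt ?_
      rw [div_lt_iff₀ (by positivity)]
      rw [div_lt_iff₀ hδpos] at hn1
      nlinarith
    have h2 : ‖t⁻¹ • (f (x.1 + t • x.2) - f x.1)‖ < ‖x.2 * c‖ + 1 := hδ' ⟨ht.1, htδ⟩
    rw [norm_smul, norm_inv, Real.norm_of_nonneg ht.1.le, inv_mul_lt_iff₀ ht.1] at h2
    nlinarith [ht.1]
  obtain ⟨n, ⟨⟨e₀, h₀⟩, hint⟩⟩ := nonempty_interior_of_iUnion_of_closed hXc hXu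
  rw [mem_interior_iff_mem_nhds, Metric.mem_nhds_iff] at hint
  obtain ⟨η, hη, hsub⟩ := hint
  rw [← ball_prod_same] at hsub
  set τ : ℝ := 1 / ((n : ℝ) + 1) with hτ
  have hτpos : 0 < τ := by positivity
  have hcone : ∀ e ∈ F ∩ ball (e₀ : ℂ) η, ∀ h ∈ ball h₀ η, ∀ t ∈ Ioc 0 τ,
      ‖f (e + t • h) - f e‖ ≤ n * t := by
    rintro e ⟨heF, heb⟩ h hh t ht
    exact hsub (show ((⟨e, heF⟩ : F), h) ∈ _ from ⟨heb, hh⟩) t ht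
  obtain ⟨ρ₀, hρ₀, hρ₀D⟩ := Metric.isOpen_iff.mp hD e₀ e₀.2.1
  -- Two points of the ball of radius `ρ` are less than `2 * ρ` apart; the last condition is then
  -- the distance hypothesis of `norm_sub_le_of_cone`.
  obtain ⟨ρ, hρ, hρη, hρρ₀, hρτ⟩ : ∃ ρ > 0, ρ ≤ η ∧ ρ ≤ ρ₀ ∧ 2 / η * (2 * ρ) ≤ τ := by
    refine ⟨min (min η ρ₀) (τ * η / 4), by positivity,
      (min_le_left _ _).trans (min_le_left _ _), (min_le_left _ _).trans (min_le_right _ _), ?_⟩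
    have := min_le_right (min η ρ₀) (τ * η / 4)
    calc 2 / η * (2 * min (min η ρ₀) (τ * η / 4)) ≤ 2 / η * (2 * (τ * η / 4)) := by gcongr
      _ = τ := by field_simp; norm_num
  have hρD : ball (e₀ : ℂ) ρ ⊆ D := (ball_subset_ball hρρ₀).trans hρ₀D
  obtain ⟨M, hM⟩ := (isCompact_closedBall (e₀ : ℂ) ρ).exists_bound_of_continuousOn hf.continuousOn
  have hM0 : 0 ≤ M := (norm_nonneg _).trans (hM e₀ (mem_closedBall_self hρ.le))
  set r := ρ / 2 with hr
  have hrpos : 0 < r := by positivity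
  have hin : ∀ e ∈ ball (e₀ : ℂ) r, closedBall e r ⊆ ball (e₀ : ℂ) ρ := by
    intro e he z hz
    rw [mem_ball] at he ⊢
    rw [mem_closedBall] at hz
    linarith [dist_triangle z e e₀]
  have hlip := lipschitzOnWith_of_norm_sub_le (r := r)
    (C := 4 * n / η * (1 + 2 * ‖h₀‖ / η) + 2 * n / η + 2 * (2 * M) / r) hdiff (by positivity)
    e₀.2 (by rw [hr, mul_div_cancel₀ _ two_ne_zero]; exact hρD) ?_
  · have hd := differentiableOn_ball_of_lipschitzOn (R := r / 16) hf (by positivity)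
      (hlip.mono (ball_subset_ball (by linarith)))
      fun z hz => hdir z (hρD (ball_subset_ball (by linarith) hz))
    refine e₀.2.2 ⟨e₀.2.1, ?_⟩
    filter_upwards [ball_mem_nhds (e₀ : ℂ) (show 0 < r / 16 by positivity)] with z hz
    exact (hd z hz).differentiableAt (isOpen_ball.mem_nhds hz)
  · intro e heF her z hz
    have heρ : e ∈ ball (e₀ : ℂ) ρ := hin e her (mem_closedBall_self hrpos.le)
    have heη : e ∈ F ∩ ball (e₀ : ℂ) η := ⟨heF, ball_subset_ball hρη heρ⟩
    refine norm_sub_le_of_cone_of_differentiableAt hf hDFo hdiff hη hτpos hrpos n.cast_nonneg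
      (by positivity) (by positivity) heF (hcone e heη) ((hin e her).trans hρD) ?_ ?_ hz
    · intro y hy
      refine (norm_sub_le _ _).trans ?_
      linarith [hM y (ball_subset_closedBall (hin e her hy)), hM e (ball_subset_closedBall heρ)]
    · intro y hy hyF
      have hyρ := hin e her hy
      refine norm_sub_le_of_cone hη hcone ⟨hyF, ball_subset_ball hρη hyρ⟩ heη ?_
      refine le_trans ?_ hρτ
      gcongr
      rw [← dist_eq_norm]
      rw [mem_ball] at hyρ heρ
      linarith [dist_triangle_right y e e₀]

/-- A continuous function on an open set all of whose one-sided directional derivatives exist and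
are given by the multiplication by a complex number is holomorphic. -/
theorem differentiableOn_of_hasGateauxDeriv {f : ℂ → ℂ} {D : Set ℂ} (hD : IsOpen D)
    (hf : ContinuousOn f D) (hdir : ∀ z ∈ D, ∃ c, HasGateauxDeriv f c z) :
    DifferentiableOn ℂ f D := by
  intro z hz
  obtain ⟨r, hr, hrD⟩ := Metric.nhds_basis_closedBall.mem_iff.mp (hD.mem_nhds hz)
  -- Tietze extension from a closed disc, since the convolutions need a function that is continuous
  -- on the whole plane.
  obtain ⟨g, hg⟩ := ContinuousMap.exists_restrict_eq (isClosed_closedBall (x := z) (ε := r))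
    ⟨(closedBall z r).domRestrict f, (hf.mono hrD).domRestrict⟩
  have hgf : ∀ y ∈ closedBall z r, g y = f y := fun y hy => 
    DFunLike.congr_fun hg ⟨y, hy⟩
  have hg' : DifferentiableOn ℂ g (ball z r) := by
    refine differentiableOn_of_hasGateauxDeriv_of_continuous g.continuous isOpen_ball ?_
    intro y hy
    obtain ⟨c, hc⟩ := hdir y (hrD (ball_subset_closedBall hy))
    refine ⟨c, fun h => (hc h).congr' ?_⟩
    have hcont : Tendsto (fun ε : ℝ => y + ε • h) (𝓝[>] 0) (𝓝 y) := by
      have : Continuous fun ε : ℝ => y + ε • h := by fun_prop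
      simpa using (this.tendsto 0).mono_left nhdsWithin_le_nhds
    filter_upwards [hcont (isOpen_ball.mem_nhds hy)] with ε hε
    rw [hgf _ (ball_subset_closedBall hε), hgf _ (ball_subset_closedBall hy)]
  have hzat : DifferentiableAt ℂ g z := hg'.differentiableAt (ball_mem_nhds z hr)
  refine (hzat.congr_of_eventuallyEq ?_).differentiableWithinAt
  filter_upwards [closedBall_mem_nhds z hr] with y hy using (hgf y hy).symm

end MonogenicAlg

/-! ### Riemann–Stieltjes integrals along rectifiable curves -/

namespace MonogenicAlg

namespace TaggedDivision

variable (P : TaggedDivision)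

theorem x_le_of_le {i j : ℕ} (hij : i ≤ j) (hj : j ≤ P.N) : P.x i ≤ P.x j := by
  induction j, hij using Nat.le_induction with
  | base => exact le_rfl
  | succ k _ ih => exact (ih (by omega)).trans (P.x_le k (by omega))

theorem x_mem {i : ℕ} (hi : i ≤ P.N) : P.x i ∈ Icc (0 : ℝ) 1 :=
  ⟨P.x_zero ▸ P.x_le_of_le (Nat.zero_le i) hi, P.x_last ▸ P.x_le_of_le hi le_rfl⟩

theorem tag_mem {i : ℕ} (hi : i < P.N) : P.τ i ∈ Icc (0 : ℝ) 1 :=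
  ⟨(P.x_mem hi.le).1.trans (P.τ_mem i hi).1, (P.τ_mem i hi).2.trans (P.x_mem hi).2⟩

end TaggedDivision

theorem eventually_mesh_le {δ : ℝ} (hδ : 0 < δ) :
    ∀ᶠ P in meshFilter, ∀ i < P.N, P.x (i + 1) - P.x i ≤ δ :=
  mem_iInf_of_mem δ (mem_iInf_of_mem hδ (mem_principal_self _))

/-- Uniform divisions have arbitrarily small mesh. Uniqueness of the integral depends on this. -/
instance : meshFilter.NeBot := by
  have hb : meshFilter.HasBasis (fun δ : ℝ => δ ∈ Ioi (0 : ℝ))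
      fun δ => {P | ∀ i < P.N, P.x (i + 1) - P.x i ≤ δ} := by
    refine hasBasis_biInf_principal ?_ ⟨1, mem_Ioi.mpr one_pos⟩
    intro a ha b hb
    exact ⟨min a b, mem_Ioi.mpr (lt_min ha hb), fun P hP i hi => (hP i hi).trans (min_le_left _ _),
      fun P hP i hi => (hP i hi).trans (min_le_right _ _)⟩
  rw [hb.neBot_iff]
  intro δ hδ
  obtain ⟨n, hn⟩ := exists_nat_one_div_lt (mem_Ioi.mp hδ)
  refine ⟨⟨n + 1, fun i => i / ((n : ℝ) + 1), fun i => i / ((n : ℝ) + 1), by simp, ?_, ?_, ?_⟩, ?_⟩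
  · push_cast
    exact div_self (by positivity)
  · intro i _
    push_cast
    gcongr
    linarith
  · intro i _
    refine ⟨le_rfl, ?_⟩
    push_cast
    gcongr
    linarith
  · intro i _
    push_cast
    rw [← sub_div, add_sub_cancel_left]
    exact hn.le

/-- The integral sum of `g` with respect to `γ` for a tagged division of `[0, 1]`. -/
noncomputable def stieltjesSum (γ g : ℝ → ℂ) (P : TaggedDivision) : ℂ :=
  ∑ i ∈ Finset.range P.N, (γ (P.x (i + 1)) - γ (P.x i)) * g (P.τ i)

/-- The Riemann–Stieltjes integral of `g` with respect to `γ` over `[0, 1]` is `J`. -/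
def HasStieltjes (γ g : ℝ → ℂ) (J : ℂ) : Prop :=
  Tendsto (stieltjesSum γ g) meshFilter (𝓝 J)

theorem hasContourIntegral_iff {γ : ℝ → ℂ} {f : ℂ → ℂ} {J : ℂ} :
    HasContourIntegral γ f J ↔ HasStieltjes γ (fun t => f (γ t)) J := Iff.rfl

section Basic

variable {γ g g' : ℝ → ℂ} {J J' : ℂ}

theorem HasStieltjes.unique (h : HasStieltjes γ g J) (h' : HasStieltjes γ g J') : J = J' :=
  tendsto_nhds_unique h h'

theorem stieltjesSum_congr (h : ∀ t ∈ Icc (0 : ℝ) 1, g t = g' t) :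
    stieltjesSum γ g = stieltjesSum γ g' := by
  ext P
  refine Finset.sum_congr rfl fun i hi => ?_
  rw [h _ (P.tag_mem (Finset.mem_range.mp hi))]

theorem HasStieltjes.congr (h : HasStieltjes γ g J) (hg : ∀ t ∈ Icc (0 : ℝ) 1, g t = g' t) :
    HasStieltjes γ g' J := by
  unfold HasStieltjes
  rwa [← stieltjesSum_congr hg]

theorem HasStieltjes.add (h : HasStieltjes γ g J) (h' : HasStieltjes γ g' J') :
    HasStieltjes γ (fun t => g t + g' t) (J + J') := by
  refine (Tendsto.add h h').congr fun P => ?_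
  simp only [stieltjesSum, mul_add, Finset.sum_add_distrib]

theorem HasStieltjes.const_mul (c : ℂ) (h : HasStieltjes γ g J) :
    HasStieltjes γ (fun t => c * g t) (c * J) := by
  refine (Tendsto.const_mul c h).congr fun P => ?_
  simp only [stieltjesSum, Finset.mul_sum]
  exact Finset.sum_congr rfl fun i _ => by ring

theorem HasStieltjes.sub (h : HasStieltjes γ g J) (h' : HasStieltjes γ g' J') :
    HasStieltjes γ (fun t => g t - g' t) (J - J') := by
  refine (Tendsto.sub h h').congr fun P => ?_
  simp only [stieltjesSum, mul_sub, Finset.sum_sub_distrib]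

theorem hasStieltjes_const (γ : ℝ → ℂ) (c : ℂ) :
    HasStieltjes γ (fun _ => c) ((γ 1 - γ 0) * c) := by
  refine tendsto_const_nhds.congr fun P => ?_
  rw [stieltjesSum, ← Finset.sum_mul, Finset.sum_range_sub (fun i => γ (P.x i)), P.x_zero,
    P.x_last]

theorem HasStieltjes.sum {ι : Type*} {s : Finset ι} {g : ι → ℝ → ℂ} {J : ι → ℂ}
    (h : ∀ i ∈ s, HasStieltjes γ (g i) (J i)) :
    HasStieltjes γ (fun t => ∑ i ∈ s, g i t) (∑ i ∈ s, J i) := by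
  refine (tendsto_finsetSum s h).congr fun P => ?_
  simp only [stieltjesSum, Finset.mul_sum]
  exact Finset.sum_comm

/-- The length of the curve `γ` over `[0, 1]`. -/
noncomputable def arcLength (γ : ℝ → ℂ) : ℝ := (eVariationOn γ (Icc 0 1)).toReal

theorem arcLength_nonneg (γ : ℝ → ℂ) : 0 ≤ arcLength γ := ENNReal.toReal_nonneg

theorem sum_norm_sub_le_arcLength (hγ : BoundedVariationOn γ (Icc 0 1)) (P : TaggedDivision) :
    ∑ i ∈ Finset.range P.N, ‖γ (P.x (i + 1)) - γ (P.x i)‖ ≤ arcLength γ := by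
  have h := eVariationOn.sum_le_of_monotoneOn_Icc (f := γ) (s := Icc 0 1) (m := 0) (n := P.N)
    (u := P.x) (fun i _ j hj hij => P.x_le_of_le hij hj.2) (fun i hi => P.x_mem hi.2)
  rw [← Finset.range_eq_Ico] at h
  have h2 := ENNReal.toReal_mono hγ h
  rw [ENNReal.toReal_sum (fun i _ => edist_ne_top _ _)] at h2
  refine le_trans (le_of_eq (Finset.sum_congr rfl fun i _ => ?_)) h2
  rw [edist_dist, ENNReal.toReal_ofReal dist_nonneg, dist_eq_norm]

theorem norm_sum_mul_le {C : ℝ} (hγ : BoundedVariationOn γ (Icc 0 1)) (P : TaggedDivision)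
    {a : ℕ → ℂ} (ha : ∀ i < P.N, ‖a i‖ ≤ C) (hC : 0 ≤ C) :
    ‖∑ i ∈ Finset.range P.N, (γ (P.x (i + 1)) - γ (P.x i)) * a i‖ ≤ C * arcLength γ := by
  refine (norm_sum_le _ _).trans ?_
  calc ∑ i ∈ Finset.range P.N, ‖(γ (P.x (i + 1)) - γ (P.x i)) * a i‖
      ≤ ∑ i ∈ Finset.range P.N, C * ‖γ (P.x (i + 1)) - γ (P.x i)‖ := by
        refine Finset.sum_le_sum fun i hi => ?_
        rw [norm_mul, mul_comm]
        exact mul_le_mul_of_nonneg_right (ha i (Finset.mem_range.mp hi)) (norm_nonneg _)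
    _ ≤ C * arcLength γ := by
        rw [← Finset.mul_sum]
        exact mul_le_mul_of_nonneg_left (sum_norm_sub_le_arcLength hγ P) hC

theorem norm_stieltjesSum_sub_le {C : ℝ} (hγ : BoundedVariationOn γ (Icc 0 1))
    (h : ∀ t ∈ Icc (0 : ℝ) 1, ‖g t - g' t‖ ≤ C) (P : TaggedDivision) :
    ‖stieltjesSum γ g P - stieltjesSum γ g' P‖ ≤ C * arcLength γ := by
  have hC : 0 ≤ C := (norm_nonneg _).trans (h 0 (by simp))
  rw [stieltjesSum, stieltjesSum, ← Finset.sum_sub_distrib]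
  simp only [← mul_sub]
  exact norm_sum_mul_le hγ P (fun i hi => h _ (P.tag_mem hi)) hC

theorem HasStieltjes.norm_le {C : ℝ} (hγ : BoundedVariationOn γ (Icc 0 1))
    (hJ : HasStieltjes γ g J) (h : ∀ t ∈ Icc (0 : ℝ) 1, ‖g t‖ ≤ C) : ‖J‖ ≤ C * arcLength γ := by
  refine le_of_tendsto hJ.norm (Eventually.of_forall fun P => ?_)
  have := norm_stieltjesSum_sub_le (g' := fun _ => 0) hγ (C := C) (by simpa using h) P
  simpa [stieltjesSum] using this

end Basic

section Existence

variable {γ : ℝ → ℂ}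

/-- Tags do not decrease, so those with `τ ≤ c` form an initial segment and the sum telescopes up to
a division point near `c`. -/
theorem exists_sum_range_indicator_eq (γ : ℝ → ℂ) (P : TaggedDivision) {c δ : ℝ}
    (hc : c ∈ Icc (0 : ℝ) 1) (hδ : 0 < δ) (hP : ∀ i < P.N, P.x (i + 1) - P.x i ≤ δ) :
    ∃ j ≤ P.N, |P.x j - c| ≤ δ ∧
      stieltjesSum γ (fun t => if t ≤ c then 1 else 0) P = γ (P.x j) - γ 0 := by
  have key : ∀ k ≤ P.N, ∃ j ≤ k,
      (∑ i ∈ Finset.range k, (γ (P.x (i + 1)) - γ (P.x i)) *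
        (if P.τ i ≤ c then (1 : ℂ) else 0)) = γ (P.x j) - γ (P.x 0) ∧
      ((j = k ∧ P.x k ≤ c + δ) ∨ (c < P.x k ∧ |P.x j - c| ≤ δ)) := by
    intro k
    induction k with
    | zero =>
      intro _
      exact ⟨0, le_rfl, by simp, Or.inl ⟨rfl, by rw [P.x_zero]; linarith [hc.1]⟩⟩
    | succ k ih =>
      intro hk
      obtain ⟨j, hjk, hsum, hj⟩ := ih (by omega)
      have hτ := P.τ_mem k (by omega)
      have hx := P.x_le k (by omega)
      have hm := hP k (by omega)
      rw [Finset.sum_range_succ, hsum]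
      rcases hj with ⟨rfl, hjc⟩ | ⟨hck, hjc⟩
      · by_cases h : P.τ j ≤ c
        · refine ⟨j + 1, le_rfl, by simp [h], Or.inl ⟨rfl, ?_⟩⟩
          linarith [hτ.1]
        · refine ⟨j, by omega, by simp [h], Or.inr ⟨?_, ?_⟩⟩
          · linarith [hτ.2, not_le.mp h]
          · rw [abs_le]
            constructor <;> linarith [hτ.2, not_le.mp h]
      · have h : ¬ P.τ k ≤ c := by linarith [hτ.1]
        exact ⟨j, by omega, by simp [h], Or.inr ⟨by linarith, hjc⟩⟩
  obtain ⟨j, hj, hsum, h⟩ := key P.N le_rfl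
  refine ⟨j, hj, ?_, by rw [← P.x_zero]; exact hsum⟩
  rcases h with ⟨rfl, hle⟩ | ⟨_, hle⟩
  · rw [P.x_last] at hle ⊢
    rw [abs_le]
    constructor <;> linarith [hc.2]
  · exact hle

theorem hasStieltjes_indicator (hγ : ContinuousOn γ (Icc 0 1)) {c : ℝ} (hc : c ∈ Icc (0 : ℝ) 1) :
    HasStieltjes γ (fun t => if t ≤ c then 1 else 0) (γ c - γ 0) := by
  unfold HasStieltjes
  rw [Metric.tendsto_nhds]
  intro ε hε
  obtain ⟨δ, hδ, h⟩ := Metric.continuousOn_iff.mp hγ c hc ε hε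
  filter_upwards [eventually_mesh_le (half_pos hδ)] with P hP
  obtain ⟨j, hj, hjc, hsum⟩ := exists_sum_range_indicator_eq γ P hc (half_pos hδ) hP
  rw [hsum, dist_sub_right]
  exact h _ (P.x_mem hj) (by rw [Real.dist_eq]; linarith)

/-- Step functions are integrable because `γ` is continuous. A continuous `g` is uniformly close to
one, and bounded variation makes the sums of `g` Cauchy. -/
theorem exists_hasStieltjes (hγ : ContinuousOn γ (Icc 0 1)) (hbv : BoundedVariationOn γ (Icc 0 1))
    {g : ℝ → ℂ} (hg : ContinuousOn g (Icc 0 1)) : ∃ J, HasStieltjes γ g J := by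
  refine cauchy_map_iff_exists_tendsto.mp (Metric.cauchy_iff.mpr ⟨inferInstance, fun ε hε => ?_⟩)
  have hV := arcLength_nonneg γ
  set ε' := ε / (4 * (arcLength γ + 1)) with hε'
  have hε'pos : 0 < ε' := by positivity
  obtain ⟨δ, hδ, hunif⟩ := Metric.uniformContinuousOn_iff.mp
    (isCompact_Icc.uniformContinuousOn_of_continuous hg) ε' hε'pos
  obtain ⟨n, hn⟩ := exists_nat_one_div_lt hδ
  set N : ℕ := n + 1 with hN
  have hNpos : (0 : ℝ) < N := by positivity
  have hmem : ∀ j ≤ N, (j : ℝ) / N ∈ Icc (0 : ℝ) 1 := fun j hj =>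
    ⟨by positivity, (div_le_one hNpos).mpr (by exact_mod_cast hj)⟩
  -- Summation by parts: this combination of indicators takes on each cell the value of `g` at the
  -- right end point `⌈t N⌉ / N`.
  let s : ℝ → ℂ := fun t => g 1 + ∑ j ∈ Finset.range N,
    (g ((j : ℝ) / N) - g (((j + 1 : ℕ) : ℝ) / N)) * (if t ≤ (j : ℝ) / N then 1 else 0)
  have hs : ∀ t ∈ Icc (0 : ℝ) 1, s t = g ((⌈t * N⌉₊ : ℝ) / N) := by
    intro t ht
    have hle : ⌈t * N⌉₊ ≤ N := Nat.ceil_le.mpr (by nlinarith [ht.2])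
    have hiff : ∀ j : ℕ, t ≤ (j : ℝ) / N ↔ ⌈t * N⌉₊ ≤ j := fun j => by
      rw [le_div_iff₀ hNpos, Nat.ceil_le]
    simp only [s, hiff, mul_ite, mul_one, mul_zero]
    rw [← Finset.sum_filter]
    have hfil : (Finset.range N).filter (fun j => ⌈t * N⌉₊ ≤ j) = Finset.Ico ⌈t * N⌉₊ N := by
      ext j
      simp [and_comm]
    rw [hfil]
    have htel := Finset.sum_Ico_sub (fun j : ℕ => g ((j : ℝ) / N)) hle
    have hneg : ∑ j ∈ Finset.Ico ⌈t * N⌉₊ N, (g ((j : ℝ) / N) - g (((j + 1 : ℕ) : ℝ) / N)) =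
        -∑ j ∈ Finset.Ico ⌈t * N⌉₊ N, (g (((j + 1 : ℕ) : ℝ) / N) - g ((j : ℝ) / N)) := by
      rw [← Finset.sum_neg_distrib]
      exact Finset.sum_congr rfl fun j _ => by ring
    rw [hneg, htel, div_self hNpos.ne']
    ring
  have hsg : ∀ t ∈ Icc (0 : ℝ) 1, ‖g t - s t‖ ≤ ε' := by
    intro t ht
    rw [hs t ht, ← dist_eq_norm]
    have hle : ⌈t * N⌉₊ ≤ N := Nat.ceil_le.mpr (by nlinarith [ht.2])
    refine (hunif t ht _ (hmem _ hle) ?_).le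
    have h1 : t ≤ (⌈t * N⌉₊ : ℝ) / N := (le_div_iff₀ hNpos).mpr (Nat.le_ceil _)
    have h2 : (⌈t * N⌉₊ : ℝ) / N < t + 1 / N := by
      have := Nat.ceil_lt_add_one (mul_nonneg ht.1 hNpos.le)
      rw [div_lt_iff₀ hNpos, add_mul, one_div, inv_mul_cancel₀ hNpos.ne']
      exact this
    have h3 : 1 / (N : ℝ) < δ := by rw [hN]; push_cast; exact hn
    rw [Real.dist_eq, abs_lt]
    constructor <;> linarith
  obtain ⟨J, hJ⟩ : ∃ J, HasStieltjes γ s J :=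
    ⟨_, (hasStieltjes_const γ (g 1)).add (HasStieltjes.sum fun j hj =>
      (hasStieltjes_indicator hγ (hmem j (Finset.mem_range.mp hj).le)).const_mul _)⟩
  have hεV : ε' * arcLength γ < ε / 4 := by
    rw [hε']
    have : ε / (4 * (arcLength γ + 1)) * arcLength γ = ε / 4 * (arcLength γ / (arcLength γ + 1)) := by
      field_simp
    rw [this]
    have h1 : arcLength γ / (arcLength γ + 1) < 1 := (div_lt_one (by positivity)).mpr (by linarith)
    have : 0 < ε / 4 := by positivity
    nlinarith
  refine ⟨Metric.ball J (ε / 2), ?_, ?_⟩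
  · have := Metric.tendsto_nhds.mp hJ (ε / 4) (by positivity)
    rw [mem_map]
    filter_upwards [this] with P hP
    rw [mem_preimage, Metric.mem_ball]
    have h1 := norm_stieltjesSum_sub_le hbv hsg P
    rw [← dist_eq_norm] at h1
    linarith [dist_triangle (stieltjesSum γ g P) (stieltjesSum γ s P) J]
  · intro x hx y hy
    rw [Metric.mem_ball] at hx hy
    linarith [dist_triangle_right x y J]

end Existence

/-- Off the diagonal this is continuity of a quotient. At the diagonal, strict differentiability
controls the slopes and continuity of `deriv f` the diagonal values. -/
theorem continuousOn_dslope_uncurry {f : ℂ → ℂ} {D : Set ℂ} (hD : IsOpen D)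
    (hf : DifferentiableOn ℂ f D) :
    ContinuousOn (fun p : ℂ × ℂ => dslope f p.1 p.2) (D ×ˢ D) := by
  rintro ⟨a, b⟩ ⟨ha, hb⟩
  refine ContinuousAt.continuousWithinAt ?_
  simp only at ha hb
  have hfa := (hf.differentiableAt (hD.mem_nhds ha)).continuousAt
  have hfb := (hf.differentiableAt (hD.mem_nhds hb)).continuousAt
  rcases ne_or_eq a b with hab | rfl
  · have hne : ∀ᶠ p : ℂ × ℂ in 𝓝 (a, b), p.1 ≠ p.2 :=
      (isOpen_ne_fun continuous_fst continuous_snd).mem_nhds hab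
    have hsl : ContinuousAt (fun p : ℂ × ℂ => (p.2 - p.1)⁻¹ * (f p.2 - f p.1)) (a, b) := by
      refine ContinuousAt.mul (ContinuousAt.inv₀ (by fun_prop) (sub_ne_zero.mpr hab.symm)) ?_
      exact ContinuousAt.sub (ContinuousAt.comp (f := Prod.snd) hfb continuousAt_snd)
        (ContinuousAt.comp (f := Prod.fst) hfa continuousAt_fst)
    refine hsl.congr ?_
    filter_upwards [hne] with p hp
    rw [dslope_of_ne _ hp.symm, slope_def_module, smul_eq_mul]
  · have han : AnalyticAt ℂ f a := hf.analyticAt (hD.mem_nhds ha)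
    have hstrict := hf.analyticAt (hD.mem_nhds ha) |>.hasStrictDerivAt
    have hder : ContinuousAt (fun p : ℂ × ℂ => deriv f p.1) (a, a) :=
      ContinuousAt.comp (f := Prod.fst) (g := deriv f) (x := (a, a)) han.deriv.continuousAt
        continuousAt_fst
    rw [Metric.continuousAt_iff']
    intro ε hε
    have h1 := (hasDerivAtFilter_iff_isLittleO.mp hstrict).def (half_pos hε)
    have h2 := Metric.continuousAt_iff'.mp hder ε hε
    filter_upwards [h1, h2] with p hp1 hp2
    rw [dslope_same]
    rcases eq_or_ne p.1 p.2 with h | h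
    · rw [← h, dslope_same]
      exact hp2
    · rw [dslope_of_ne _ h.symm, slope_def_module, dist_eq_norm]
      have hne : p.2 - p.1 ≠ 0 := sub_ne_zero.mpr h.symm
      have e : (p.2 - p.1)⁻¹ • (f p.2 - f p.1) - deriv f a =
          (p.1 - p.2)⁻¹ * (f p.1 - f p.2 - (p.1 - p.2) • deriv f a) := by
        have hne' : p.1 - p.2 ≠ 0 := sub_ne_zero.mpr h
        rw [smul_eq_mul, smul_eq_mul]
        field_simp
        ring
      rw [e, norm_mul, norm_inv]
      have hpos : 0 < ‖p.1 - p.2‖ := norm_pos_iff.mpr (sub_ne_zero.mpr h)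
      have : ‖p.1 - p.2‖⁻¹ * ‖f p.1 - f p.2 - (p.1 - p.2) • deriv f a‖ ≤ ε / 2 := by
        rw [inv_mul_le_iff₀ hpos, mul_comm]
        simpa using hp1
      linarith

section ChainRule

variable {γ : ℝ → ℂ}

/-- Substitution in the Riemann–Stieltjes integral: the integral sums of `g` with respect to
`f ∘ γ` and of `(f' ∘ γ) g` with respect to `γ` have the same limit. -/
theorem tendsto_stieltjesSum_comp_sub (hγ : ContinuousOn γ (Icc 0 1))
    (hbv : BoundedVariationOn γ (Icc 0 1)) {U : Set ℂ} (hU : IsOpen U)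
    (hγU : MapsTo γ (Icc 0 1) U) {f : ℂ → ℂ} (hf : DifferentiableOn ℂ f U) {g : ℝ → ℂ}
    (hg : ContinuousOn g (Icc 0 1)) :
    Tendsto (fun P => stieltjesSum (fun t => f (γ t)) g P -
      stieltjesSum γ (fun t => deriv f (γ t) * g t) P) meshFilter (𝓝 0) := by
  obtain ⟨C, hC⟩ := isCompact_Icc.exists_bound_of_continuousOn hg
  have hC0 : 0 ≤ C := (norm_nonneg _).trans (hC 0 (by simp))
  have hq : ContinuousOn (fun p : ℝ × ℝ => dslope f (γ p.1) (γ p.2)) (Icc 0 1 ×ˢ Icc 0 1) := by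
    refine (continuousOn_dslope_uncurry hU hf).comp
      (f := fun p : ℝ × ℝ => (γ p.1, γ p.2)) ?_ ?_
    · exact (hγ.comp continuousOn_fst fun p hp => hp.1).prodMk
        (hγ.comp continuousOn_snd fun p hp => hp.2)
    · exact fun p hp => ⟨hγU hp.1, hγU hp.2⟩
  have hu := (isCompact_Icc.prod isCompact_Icc).uniformContinuousOn_of_continuous hq
  rw [Metric.uniformContinuousOn_iff] at hu
  rw [Metric.tendsto_nhds]
  intro ε hε
  have hV := arcLength_nonneg γ
  obtain ⟨δ, hδ, hδ'⟩ := hu (ε / ((C + 1) * (arcLength γ + 1))) (by positivity)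
  filter_upwards [eventually_mesh_le (half_pos hδ)] with P hP
  rw [dist_zero_right, stieltjesSum, stieltjesSum, ← Finset.sum_sub_distrib]
  -- An increment of `f ∘ γ` is the increment of `γ` times a value of `dslope f`, which by uniform
  -- continuity is close to `deriv f` at the tag when the mesh is small.
  have hterm : ∀ i ∈ Finset.range P.N,
      (f (γ (P.x (i + 1))) - f (γ (P.x i))) * g (P.τ i) -
        (γ (P.x (i + 1)) - γ (P.x i)) * (deriv f (γ (P.τ i)) * g (P.τ i)) =
      (γ (P.x (i + 1)) - γ (P.x i)) * ((dslope f (γ (P.x i)) (γ (P.x (i + 1))) -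
        dslope f (γ (P.τ i)) (γ (P.τ i))) * g (P.τ i)) := by
    intro i _
    rw [← sub_smul_dslope f, dslope_same, smul_eq_mul]
    ring
  rw [Finset.sum_congr rfl hterm]
  have hb := norm_sum_mul_le (C := ε / ((C + 1) * (arcLength γ + 1)) * C) hbv P
    (a := fun i => (dslope f (γ (P.x i)) (γ (P.x (i + 1))) -
        dslope f (γ (P.τ i)) (γ (P.τ i))) * g (P.τ i)) ?_ (by positivity)
  · refine hb.trans_lt ?_
    have e : ε / ((C + 1) * (arcLength γ + 1)) * C * arcLength γ =
        ε * ((C / (C + 1)) * (arcLength γ / (arcLength γ + 1))) := by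
      field_simp
    have h1 : C / (C + 1) < 1 := (div_lt_one (by positivity)).mpr (by linarith)
    have h2 : arcLength γ / (arcLength γ + 1) < 1 :=
      (div_lt_one (by positivity)).mpr (by linarith)
    have h3 : 0 ≤ C / (C + 1) := by positivity
    have h4 : 0 ≤ arcLength γ / (arcLength γ + 1) := by positivity
    rw [e]
    have h5 : (C / (C + 1)) * (arcLength γ / (arcLength γ + 1)) < 1 := by nlinarith
    nlinarith
  · intro i hi
    rw [norm_mul]
    refine mul_le_mul ?_ (hC _ (P.tag_mem hi)) (norm_nonneg _) (by positivity)
    rw [← dist_eq_norm]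
    have hm := hP i hi
    have ht := P.τ_mem i hi
    refine (hδ' (P.x i, P.x (i + 1)) ⟨P.x_mem hi.le, P.x_mem hi⟩ (P.τ i, P.τ i)
      ⟨P.tag_mem hi, P.tag_mem hi⟩ ?_).le
    rw [Prod.dist_eq, max_lt_iff, Real.dist_eq, Real.dist_eq, abs_lt, abs_lt]
    have := P.x_le i hi
    refine ⟨⟨?_, ?_⟩, ?_, ?_⟩ <;> simp only <;> linarith [ht.1, ht.2]

theorem HasStieltjes.comp (hγ : ContinuousOn γ (Icc 0 1))
    (hbv : BoundedVariationOn γ (Icc 0 1)) {U : Set ℂ} (hU : IsOpen U)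
    (hγU : MapsTo γ (Icc 0 1) U) {f : ℂ → ℂ} (hf : DifferentiableOn ℂ f U) {g : ℝ → ℂ}
    (hg : ContinuousOn g (Icc 0 1)) {J : ℂ}
    (hJ : HasStieltjes γ (fun t => deriv f (γ t) * g t) J) :
    HasStieltjes (fun t => f (γ t)) g J := by
  have := (tendsto_stieltjesSum_comp_sub hγ hbv hU hγU hf hg).add hJ
  rw [zero_add] at this
  exact this.congr fun P => by ring

/-- The fundamental theorem of calculus along a rectifiable curve. -/
theorem hasStieltjes_deriv (hγ : ContinuousOn γ (Icc 0 1))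
    (hbv : BoundedVariationOn γ (Icc 0 1)) {U : Set ℂ} (hU : IsOpen U)
    (hγU : MapsTo γ (Icc 0 1) U) {f : ℂ → ℂ} (hf : DifferentiableOn ℂ f U) :
    HasStieltjes γ (fun t => deriv f (γ t)) (f (γ 1) - f (γ 0)) := by
  have h := tendsto_stieltjesSum_comp_sub hγ hbv hU hγU hf (g := fun _ => 1) continuousOn_const
  have h1 := hasStieltjes_const (fun t => f (γ t)) 1
  have := Tendsto.sub h1 h
  simp only [mul_one, sub_zero] at this
  exact this.congr fun P => by ring

end ChainRule

section Parameter

variable {γ : ℝ → ℂ} {g : ℂ → ℝ → ℂ} {J : ℂ → ℂ} {D : Set ℂ}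

/-- By compactness of `[0, 1]`, `g z` is uniformly close to `g z₀` for `z` near `z₀`; the length of
`γ` bounds the resulting change of both the sums and the integral. Holomorphy in a parameter and
differentiation under the integral follow from Weierstrass' theorem. -/
theorem tendstoLocallyUniformlyOn_stieltjesSum (hbv : BoundedVariationOn γ (Icc 0 1))
    (hg : ContinuousOn (Function.uncurry g) (D ×ˢ Icc 0 1))
    (hJ : ∀ z ∈ D, HasStieltjes γ (g z) (J z)) :
    TendstoLocallyUniformlyOn (fun P z => stieltjesSum γ (g z) P) J meshFilter D := by
  rw [Metric.tendstoLocallyUniformlyOn_iff]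
  intro ε hε z₀ hz₀
  have hV := arcLength_nonneg γ
  set ε' := ε / (4 * (arcLength γ + 1)) with hε'
  have hε'pos : 0 < ε' := by positivity
  have hεV : ε' * arcLength γ ≤ ε / 4 := by
    rw [hε', div_mul_eq_mul_div, div_le_iff₀ (by positivity)]
    nlinarith
  obtain ⟨v, hv, hv'⟩ := isCompact_Icc.mem_uniformity_of_prod hg hz₀ (Metric.dist_mem_uniformity hε'pos)
  refine ⟨v ∩ D, inter_mem hv self_mem_nhdsWithin, ?_⟩
  filter_upwards [Metric.tendsto_nhds.mp (hJ z₀ hz₀) (ε / 4) (by positivity)] with P hP z hz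
  have hb : ∀ t ∈ Icc (0 : ℝ) 1, ‖g z t - g z₀ t‖ ≤ ε' := fun t ht => by
    rw [← dist_eq_norm]
    exact le_of_lt (hv' z hz.1 t ht)
  have h1 := norm_stieltjesSum_sub_le hbv hb P
  have h2 := ((hJ z hz.2).sub (hJ z₀ hz₀)).norm_le hbv hb
  rw [← dist_eq_norm] at h1 h2
  have h3 := dist_triangle4 (J z) (J z₀) (stieltjesSum γ (g z₀) P) (stieltjesSum γ (g z) P)
  rw [dist_comm] at hP h1
  linarith

theorem differentiableOn_stieltjesSum (P : TaggedDivision)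
    (hd : ∀ t ∈ Icc (0 : ℝ) 1, DifferentiableOn ℂ (fun z => g z t) D) :
    DifferentiableOn ℂ (fun z => stieltjesSum γ (g z) P) D := by
  unfold stieltjesSum
  refine DifferentiableOn.fun_sum fun i hi => ?_
  exact (hd _ (P.tag_mem (Finset.mem_range.mp hi))).const_mul _

theorem differentiableOn_of_hasStieltjes (hbv : BoundedVariationOn γ (Icc 0 1)) (hD : IsOpen D)
    (hg : ContinuousOn (Function.uncurry g) (D ×ˢ Icc 0 1))
    (hd : ∀ t ∈ Icc (0 : ℝ) 1, DifferentiableOn ℂ (fun z => g z t) D)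
    (hJ : ∀ z ∈ D, HasStieltjes γ (g z) (J z)) : DifferentiableOn ℂ J D :=
  (tendstoLocallyUniformlyOn_stieltjesSum hbv hg hJ).differentiableOn
    (Eventually.of_forall fun P => differentiableOn_stieltjesSum P hd) hD

/-- Differentiation under the integral sign. -/
theorem hasStieltjes_deriv_param (hbv : BoundedVariationOn γ (Icc 0 1)) (hD : IsOpen D)
    (hg : ContinuousOn (Function.uncurry g) (D ×ˢ Icc 0 1))
    (hd : ∀ t ∈ Icc (0 : ℝ) 1, DifferentiableOn ℂ (fun z => g z t) D)
    (hJ : ∀ z ∈ D, HasStieltjes γ (g z) (J z)) {z : ℂ} (hz : z ∈ D) :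
    HasStieltjes γ (fun t => deriv (fun y => g y t) z) (deriv J z) := by
  have h := ((tendstoLocallyUniformlyOn_stieltjesSum hbv hg hJ).deriv
    (Eventually.of_forall fun P => differentiableOn_stieltjesSum P hd) hD).tendsto_at hz
  refine h.congr fun P => ?_
  simp only [Function.comp_apply, stieltjesSum]
  rw [deriv_fun_sum]
  · refine Finset.sum_congr rfl fun i hi => ?_
    exact deriv_const_mul _ ((hd _ (P.tag_mem (Finset.mem_range.mp hi))).differentiableAt
      (hD.mem_nhds hz))
  · intro i hi
    exact ((hd _ (P.tag_mem (Finset.mem_range.mp hi))).differentiableAt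
      (hD.mem_nhds hz)).const_mul _

end Parameter

/-! ### The complement of a curve, winding numbers and Cauchy's theorem -/

section Outside

variable {γ : ℝ → ℂ}

theorem isCompact_trace (hγ : ContinuousOn γ (Icc 0 1)) : IsCompact (trace γ) :=
  isCompact_Icc.image_of_continuousOn hγ

theorem mem_trace {t : ℝ} (ht : t ∈ Icc (0 : ℝ) 1) : γ t ∈ trace γ := mem_image_of_mem γ ht

/-- The points that lie in the unbounded components of the complement of a curve. -/
def outside (γ : ℝ → ℂ) : Set ℂ := (trace γ)ᶜ \ inside γ

theorem not_isBounded_of_mem_outside {z : ℂ} (hz : z ∈ outside γ) :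
    ¬ Bornology.IsBounded (connectedComponentIn (trace γ)ᶜ z) :=
  fun h => hz.2 ⟨hz.1, h⟩

theorem isOpen_outside (hγ : ContinuousOn γ (Icc 0 1)) : IsOpen (outside γ) := by
  have hO : IsOpen (trace γ)ᶜ := (isCompact_trace hγ).isClosed.isOpen_compl
  rw [isOpen_iff_forall_mem_open]
  intro z hz
  refine ⟨connectedComponentIn (trace γ)ᶜ z, fun y hy => ?_, hO.connectedComponentIn,
    mem_connectedComponentIn hz.1⟩
  refine ⟨connectedComponentIn_subset _ _ hy, fun h => not_isBounded_of_mem_outside hz ?_⟩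
  rw [connectedComponentIn_eq hy]
  exact h.2

/-- The ray from `z` pointing away from `c` is connected, unbounded and misses the curve. -/
theorem mem_outside_of_lt_dist {c : ℂ} {R : ℝ} (hR : trace γ ⊆ Metric.closedBall c R) {z : ℂ}
    (hR0 : 0 ≤ R) (hz : R < dist z c) : z ∈ outside γ := by
  have hpos : 0 < dist z c := hR0.trans_lt hz
  let ray : Set ℂ := (fun s : ℝ => c + s • (z - c)) '' Ici 1
  have hdist : ∀ s : ℝ, 1 ≤ s → dist (c + s • (z - c)) c = s * dist z c := by
    intro s hs
    rw [dist_eq_norm, add_sub_cancel_left, norm_smul, Real.norm_of_nonneg (by linarith),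
      dist_eq_norm]
  have hray : ray ⊆ (trace γ)ᶜ := by
    rintro _ ⟨s, hs, rfl⟩ hmem
    have h1 := hR hmem
    rw [Metric.mem_closedBall, hdist s hs] at h1
    nlinarith [mem_Ici.mp hs]
  have hzray : z ∈ ray := ⟨1, self_mem_Ici, by simp⟩
  have hconn : IsPreconnected ray :=
    isPreconnected_Ici.image _ (by fun_prop : Continuous fun s : ℝ => c + s • (z - c)).continuousOn
  refine ⟨hray hzray, fun h => ?_⟩
  obtain ⟨B, hB⟩ := (h.2.subset (hconn.subset_connectedComponentIn hzray hray)).subset_closedBall c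
  have h1 : c + (max 1 ((B + 1) / dist z c)) • (z - c) ∈ ray :=
    ⟨_, mem_Ici.mpr (le_max_left _ _), rfl⟩
  have h2 := hB h1
  rw [Metric.mem_closedBall, hdist _ (le_max_left _ _)] at h2
  have h3 := mul_le_mul_of_nonneg_right (le_max_right 1 ((B + 1) / dist z c)) hpos.le
  rw [div_mul_cancel₀ _ hpos.ne'] at h3
  linarith

end Outside

section Winding

variable {γ : ℝ → ℂ}

theorem continuousOn_inv_sub (hγ : ContinuousOn γ (Icc 0 1)) :
    ContinuousOn (Function.uncurry fun (z : ℂ) (t : ℝ) => (γ t - z)⁻¹)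
      ((trace γ)ᶜ ×ˢ Icc 0 1) := by
  refine ContinuousOn.inv₀ ((hγ.comp continuousOn_snd fun p hp => hp.2).sub continuousOn_fst) ?_
  rintro ⟨z, t⟩ ⟨hz, ht⟩ h
  exact hz (sub_eq_zero.mp h ▸ mem_trace ht)

/-- The integral of `(t - z)⁻¹` along a closed curve is constant in connected parts of the
complement of the curve. -/
theorem hasStieltjes_inv_sub_of_isPreconnected (hγ : ContinuousOn γ (Icc 0 1))
    (hbv : BoundedVariationOn γ (Icc 0 1)) (hcl : γ 0 = γ 1) {S : Set ℂ} (hS : IsOpen S)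
    (hSp : IsPreconnected S) (hSt : S ⊆ (trace γ)ᶜ) {z y : ℂ} (hz : z ∈ S) (hy : y ∈ S) {c : ℂ}
    (h : HasStieltjes γ (fun t => (γ t - z)⁻¹) c) : HasStieltjes γ (fun t => (γ t - y)⁻¹) c := by
  have hne : ∀ x ∈ S, ∀ t ∈ Icc (0 : ℝ) 1, γ t - x ≠ 0 := fun x hx t ht h0 =>
    hSt hx (sub_eq_zero.mp h0 ▸ mem_trace ht)
  have hex : ∀ x, ∃ W, x ∈ S → HasStieltjes γ (fun t => (γ t - x)⁻¹) W := by
    intro x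
    by_cases hx : x ∈ S
    · obtain ⟨W, hW⟩ := exists_hasStieltjes hγ hbv (g := fun t => (γ t - x)⁻¹)
        ((hγ.sub continuousOn_const).inv₀ (hne x hx))
      exact ⟨W, fun _ => hW⟩
    · exact ⟨0, fun h => absurd h hx⟩
  choose W hW using hex
  have hg := (continuousOn_inv_sub hγ).mono (prod_mono_left hSt)
  have hd : ∀ t ∈ Icc (0 : ℝ) 1, DifferentiableOn ℂ (fun x => (γ t - x)⁻¹) S := fun t ht =>
    DifferentiableOn.inv (by fun_prop) fun x hx => hne x hx t ht
  have hWd := differentiableOn_of_hasStieltjes hbv hS hg hd hW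
  -- The derivative of `(γ t - x)⁻¹` in `x` is also the derivative of `w ↦ -(w - x)⁻¹` at `γ t`. Its
  -- integral therefore vanishes along a closed curve.
  have hW0 : EqOn (deriv W) 0 S := by
    intro x hx
    have h1 := hasStieltjes_deriv_param hbv hS hg hd hW hx
    have h2 := hasStieltjes_deriv hγ hbv (U := {x}ᶜ) isOpen_compl_singleton
      (fun t ht => sub_ne_zero.mp (hne x hx t ht)) (f := fun w => -(w - x)⁻¹) (fun w hw => by
        refine DifferentiableAt.differentiableWithinAt (DifferentiableAt.neg ?_)
        exact DifferentiableAt.inv (by fun_prop) (sub_ne_zero.mpr hw))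
    rw [hcl, sub_self] at h2
    refine h1.unique (h2.congr fun t ht => ?_)
    have hn := hne x hx t ht
    have e1 : HasDerivAt (fun w => -(w - x)⁻¹) (1 / (γ t - x) ^ 2) (γ t) := by
      have := (((hasDerivAt_id (γ t)).sub_const x).inv hn).neg
      exact this.congr_deriv (by simp [neg_div])
    have e2 : HasDerivAt (fun y => (γ t - y)⁻¹) (1 / (γ t - x) ^ 2) x := by
      have := ((hasDerivAt_id x).const_sub (γ t)).inv hn
      exact this.congr_deriv (by simp)
    rw [e1.deriv, e2.deriv]
  have : W y = c := by
    rw [hS.is_const_of_deriv_eq_zero hSp hWd hW0 hy hz]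
    exact (hW z hz).unique h
  exact this ▸ hW y hy

/-- The integral is constant on the component of `z`, which is unbounded, and it is arbitrarily
small at points far from the curve. -/
theorem hasStieltjes_inv_sub_of_mem_outside (hγ : ContinuousOn γ (Icc 0 1))
    (hbv : BoundedVariationOn γ (Icc 0 1)) (hcl : γ 0 = γ 1) {z : ℂ} (hz : z ∈ outside γ) :
    HasStieltjes γ (fun t => (γ t - z)⁻¹) 0 := by
  have hO : IsOpen (trace γ)ᶜ := (isCompact_trace hγ).isClosed.isOpen_compl
  obtain ⟨c, hc⟩ := exists_hasStieltjes hγ hbv (g := fun t => (γ t - z)⁻¹)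
    ((hγ.sub continuousOn_const).inv₀ fun t ht h0 => hz.1 ((sub_eq_zero.mp h0 : γ t = z) ▸ mem_trace ht))
  obtain ⟨R, hR⟩ := (isCompact_trace hγ).isBounded.subset_closedBall 0
  have hbound : ∀ n : ℕ, ‖c‖ ≤ 1 / ((n : ℝ) + 1) * arcLength γ := by
    intro n
    obtain ⟨y, hy, hyn⟩ : ∃ y ∈ connectedComponentIn (trace γ)ᶜ z, R + (n + 1) < ‖y‖ := by
      by_contra! hcon
      refine not_isBounded_of_mem_outside hz ?_
      exact Metric.isBounded_closedBall.subset fun y hy => mem_closedBall_zero_iff.mpr (hcon y hy)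
    have h1 := hasStieltjes_inv_sub_of_isPreconnected hγ hbv hcl hO.connectedComponentIn
      isPreconnected_connectedComponentIn (connectedComponentIn_subset _ _)
      (mem_connectedComponentIn hz.1) hy hc
    refine h1.norm_le hbv fun t ht => ?_
    have h2 : ‖γ t‖ ≤ R := mem_closedBall_zero_iff.mp (hR (mem_trace ht))
    have h3 : (n : ℝ) + 1 ≤ ‖γ t - y‖ := by
      rw [norm_sub_rev]
      linarith [norm_sub_norm_le y (γ t)]
    rw [norm_inv, one_div]
    exact inv_anti₀ (by positivity) h3
  have hlim : Tendsto (fun n : ℕ => 1 / ((n : ℝ) + 1) * arcLength γ) atTop (𝓝 0) := by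
    simpa using tendsto_one_div_add_atTop_nhds_zero_nat.mul_const (arcLength γ)
  have : c = 0 := by
    rw [← norm_le_zero_iff]
    exact ge_of_tendsto' hlim hbound
  exact this ▸ hc

end Winding

section Cauchy

variable {γ : ℝ → ℂ} {D : Set ℂ} {f : ℂ → ℂ}

/-- Dixon's form of the Cauchy theorem for a closed rectifiable curve that lies in the open set `D`
together with the bounded components of its complement. -/
theorem hasStieltjes_dslope (hγ : ContinuousOn γ (Icc 0 1))
    (hbv : BoundedVariationOn γ (Icc 0 1)) (hcl : γ 0 = γ 1) (hD : IsOpen D)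
    (htr : trace γ ⊆ D) (hin : inside γ ⊆ D) (hf : DifferentiableOn ℂ f D) {z : ℂ} (hz : z ∈ D) :
    HasStieltjes γ (fun t => dslope f z (γ t)) 0 := by
  classical
  have hfγ : ContinuousOn (fun t => f (γ t)) (Icc 0 1) :=
    hf.continuousOn.comp hγ fun t ht => htr (mem_trace ht)
  have hqc : ContinuousOn (Function.uncurry fun (x : ℂ) (t : ℝ) => dslope f x (γ t))
      (D ×ˢ Icc 0 1) := by
    refine (continuousOn_dslope_uncurry hD hf).comp (f := fun p : ℂ × ℝ => (p.1, γ p.2))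
      (continuousOn_fst.prodMk (hγ.comp continuousOn_snd fun p hp => hp.2)) ?_
    exact fun p hp => ⟨hp.1, htr (mem_trace hp.2)⟩
  have hex1 : ∀ x, ∃ J, x ∈ D → HasStieltjes γ (fun t => dslope f x (γ t)) J := by
    intro x
    by_cases hx : x ∈ D
    · obtain ⟨J, hJ⟩ := exists_hasStieltjes hγ hbv (g := fun t => dslope f x (γ t))
        (hqc.comp (f := fun t => (x, t)) (by fun_prop) fun t ht => ⟨hx, ht⟩)
      exact ⟨J, fun _ => hJ⟩
    · exact ⟨0, fun h => absurd h hx⟩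
  choose J hJ using hex1
  have hne : ∀ x ∈ outside γ, ∀ t ∈ Icc (0 : ℝ) 1, γ t - x ≠ 0 := fun x hx t ht h0 =>
    hx.1 (sub_eq_zero.mp h0 ▸ mem_trace ht)
  have hkc : ContinuousOn (Function.uncurry fun (x : ℂ) (t : ℝ) => f (γ t) * (γ t - x)⁻¹)
      (outside γ ×ˢ Icc 0 1) :=
    (hfγ.comp continuousOn_snd fun p hp => hp.2).mul
      ((continuousOn_inv_sub hγ).mono (prod_mono_left sdiff_subset))
  have hex2 : ∀ x, ∃ K, x ∈ outside γ → HasStieltjes γ (fun t => f (γ t) * (γ t - x)⁻¹) K := by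
    intro x
    by_cases hx : x ∈ outside γ
    · obtain ⟨K, hK⟩ := exists_hasStieltjes hγ hbv (g := fun t => f (γ t) * (γ t - x)⁻¹)
        (hkc.comp (f := fun t => (x, t)) (by fun_prop) fun t ht => ⟨hx, ht⟩)
      exact ⟨K, fun _ => hK⟩
    · exact ⟨0, fun h => absurd h hx⟩
  choose K hK using hex2
  have hJd : DifferentiableOn ℂ J D := by
    refine differentiableOn_of_hasStieltjes hbv hD hqc (fun t ht => ?_) hJ
    have hsymm : ∀ x, dslope f x (γ t) = dslope f (γ t) x := by
      intro x
      rcases eq_or_ne x (γ t) with rfl | h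
      · rfl
      · rw [dslope_of_ne _ h.symm, dslope_of_ne _ h, slope_comm]
    simp only [hsymm]
    exact (Complex.differentiableOn_dslope (hD.mem_nhds (htr (mem_trace ht)))).mpr hf
  have hKd : DifferentiableOn ℂ K (outside γ) := by
    refine differentiableOn_of_hasStieltjes hbv (isOpen_outside hγ) hkc (fun t ht => ?_) hK
    exact (DifferentiableOn.inv (by fun_prop) fun x hx => hne x hx t ht).const_mul _
  -- The two integrals differ by `f x` times the integral of `(t - x)⁻¹`, which vanishes outside the
  -- curve.
  have hJK : ∀ x ∈ D, x ∈ outside γ → J x = K x := by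
    intro x hxD hx
    have h1 := (hK x hx).sub
      ((hasStieltjes_inv_sub_of_mem_outside hγ hbv hcl hx).const_mul (f x))
    rw [mul_zero, sub_zero] at h1
    refine (hJ x hxD).unique (h1.congr fun t ht => ?_)
    rw [dslope_of_ne _ (sub_ne_zero.mp (hne x hx t ht)), slope_def_field]
    ring
  -- `D` contains the curve and its inside, so `D` and `outside γ` cover the plane and the glued
  -- function is entire. It tends to zero at infinity, hence vanishes by Liouville's theorem.
  let h : ℂ → ℂ := fun x => if x ∈ D then J x else K x
  have hhK : ∀ x ∈ outside γ, h x = K x := by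
    intro x hx
    by_cases hxD : x ∈ D
    · simp only [h, if_pos hxD, hJK x hxD hx]
    · simp only [h, if_neg hxD]
  have hhd : Differentiable ℂ h := by
    intro x
    by_cases hxD : x ∈ D
    · refine (hJd.differentiableAt (hD.mem_nhds hxD)).congr_of_eventuallyEq ?_
      filter_upwards [hD.mem_nhds hxD] with y hy
      simp only [h, if_pos hy]
    · have hx : x ∈ outside γ := ⟨fun h => hxD (htr h), fun h => hxD (hin h)⟩
      refine (hKd.differentiableAt ((isOpen_outside hγ).mem_nhds hx)).congr_of_eventuallyEq ?_
      filter_upwards [(isOpen_outside hγ).mem_nhds hx] with y hy using hhK y hy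
  obtain ⟨C, hC⟩ := isCompact_Icc.exists_bound_of_continuousOn hfγ
  obtain ⟨R₀, hR₀⟩ := (isCompact_trace hγ).isBounded.subset_closedBall 0
  have hR : trace γ ⊆ Metric.closedBall 0 (max R₀ 0) :=
    hR₀.trans (Metric.closedBall_subset_closedBall (le_max_left _ _))
  set R := max R₀ 0
  have hlim : Tendsto h (cocompact ℂ) (𝓝 0) := by
    have hb : Tendsto (fun x : ℂ => C * (‖x‖ - R)⁻¹ * arcLength γ) (cocompact ℂ) (𝓝 0) := by
      have h1 : Tendsto (fun x : ℂ => ‖x‖ - R) (cocompact ℂ) atTop :=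
        tendsto_atTop_add_const_right _ _ (tendsto_norm_cocompact_atTop (E := ℂ))
      simpa using (h1.inv_tendsto_atTop.const_mul C).mul_const (arcLength γ)
    refine squeeze_zero_norm' ?_ hb
    filter_upwards [(tendsto_norm_cocompact_atTop (E := ℂ)).eventually_gt_atTop R] with x hx
    have hxo : x ∈ outside γ :=
      mem_outside_of_lt_dist hR (le_max_right _ _) (by rwa [dist_zero_right])
    rw [hhK x hxo]
    refine (hK x hxo).norm_le hbv fun t ht => ?_
    rw [norm_mul, norm_inv]
    have h2 : ‖γ t‖ ≤ R := mem_closedBall_zero_iff.mp (hR (mem_trace ht))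
    have h3 : ‖x‖ - R ≤ ‖γ t - x‖ := by
      rw [norm_sub_rev]
      linarith [norm_sub_norm_le x (γ t)]
    have h4 : 0 < ‖x‖ - R := sub_pos.mpr hx
    exact mul_le_mul (hC t ht) (inv_anti₀ h4 h3) (by positivity)
      ((norm_nonneg _).trans (hC t ht))
  have hz0 : J z = 0 := by
    have := hhd.apply_eq_of_tendsto_cocompact z hlim
    simpa only [h, if_pos hz] using this
  exact hz0 ▸ hJ z hz

/-- The Cauchy integral formula for derivatives along a positively oriented closed rectifiable
curve. -/
theorem hasStieltjes_cauchy (hγ : ContinuousOn γ (Icc 0 1))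
    (hbv : BoundedVariationOn γ (Icc 0 1)) (hcl : γ 0 = γ 1) (hor : IsPositivelyOriented γ)
    (hD : IsOpen D) (htr : trace γ ⊆ D) (hin : inside γ ⊆ D) (hf : DifferentiableOn ℂ f D)
    {ξ : ℂ} (hξ : ξ ∈ inside γ) (k : ℕ) :
    HasStieltjes γ (fun t => f (γ t) * ((γ t - ξ) ^ (k + 1))⁻¹)
      (2 * Real.pi * Complex.I * (iteratedDeriv k f ξ / k.factorial)) := by
  have hne : ∀ t ∈ Icc (0 : ℝ) 1, γ t - ξ ≠ 0 := fun t ht h0 =>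
    hξ.1 (sub_eq_zero.mp h0 ▸ mem_trace ht)
  induction k generalizing f with
  | zero =>
    have hor' : HasStieltjes γ (fun t => (γ t - ξ)⁻¹) (2 * Real.pi * Complex.I) :=
      (hasContourIntegral_iff (f := fun w => (w - ξ)⁻¹)).mp (hor ξ hξ)
    have h1 := (hasStieltjes_dslope hγ hbv hcl hD htr hin hf (hin hξ)).add (hor'.const_mul (f ξ))
    have e : 2 * Real.pi * Complex.I * (iteratedDeriv 0 f ξ / (Nat.factorial 0 : ℂ)) =
        0 + f ξ * (2 * Real.pi * Complex.I) := by
      simp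
      ring
    rw [e]
    refine h1.congr fun t ht => ?_
    rw [dslope_of_ne _ (sub_ne_zero.mp (hne t ht)), slope_def_field]
    ring
  | succ k ih =>
    -- Integration by parts: the formula of order `k` for `deriv f`, minus the vanishing integral of
    -- the derivative of `f w * ((w - ξ) ^ (k + 1))⁻¹`, leaves `k + 1` times the desired integral.
    have h1 := ih (hf.deriv hD)
    have h2 := hasStieltjes_deriv hγ hbv (U := D ∩ {ξ}ᶜ) (hD.inter isOpen_compl_singleton)
      (fun t ht => ⟨htr (mem_trace ht), sub_ne_zero.mp (hne t ht)⟩)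
      (f := fun w => f w * ((w - ξ) ^ (k + 1))⁻¹) (by
        refine (hf.mono inter_subset_left).mul (DifferentiableOn.inv (by fun_prop) ?_)
        exact fun w hw => pow_ne_zero _ (sub_ne_zero.mpr hw.2))
    rw [hcl, sub_self] at h2
    have h3 := (h1.sub h2).const_mul (1 / ((k : ℂ) + 1))
    have hk : (k : ℂ) + 1 ≠ 0 := by exact_mod_cast k.succ_ne_zero
    have e : 2 * Real.pi * Complex.I * (iteratedDeriv (k + 1) f ξ / ((k + 1).factorial : ℂ)) =
        1 / ((k : ℂ) + 1) *
          (2 * Real.pi * Complex.I * (iteratedDeriv k (deriv f) ξ / (k.factorial : ℂ)) - 0) := by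
      rw [iteratedDeriv_succ', Nat.factorial_succ]
      have : (k.factorial : ℂ) ≠ 0 := by exact_mod_cast k.factorial_ne_zero
      push_cast
      field_simp
      ring
    rw [e]
    refine h3.congr fun t ht => ?_
    have hn := hne t ht
    have hft : HasDerivAt f (deriv f (γ t)) (γ t) :=
      (hf.differentiableAt (hD.mem_nhds (htr (mem_trace ht)))).hasDerivAt
    have hp : HasDerivAt (fun w => ((w - ξ) ^ (k + 1))⁻¹)
        (-(((k + 1 : ℕ) : ℂ) * (γ t - ξ) ^ k) / ((γ t - ξ) ^ (k + 1)) ^ 2) (γ t) := by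
      have := (((hasDerivAt_id (γ t)).sub_const ξ).fun_pow (k + 1)).fun_inv (pow_ne_zero _ hn)
      simpa using this
    rw [(hft.fun_mul hp).deriv]
    push_cast
    field_simp
    ring

end Cauchy

/-! ### Circles and the existence of admissible curves -/

section Circle

/-- The circle of radius `r` about `ξ`, parametrized by `[0, 1]`. -/
noncomputable def circleLoop (ξ : ℂ) (r : ℝ) (t : ℝ) : ℂ := circleMap ξ r (2 * Real.pi * t)

variable {ξ : ℂ} {r : ℝ}

theorem continuous_circleLoop (ξ : ℂ) (r : ℝ) : Continuous (circleLoop ξ r) :=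
  (continuous_circleMap ξ r).comp (by fun_prop)

theorem circleLoop_zero_eq_one (ξ : ℂ) (r : ℝ) : circleLoop ξ r 0 = circleLoop ξ r 1 := by
  have := periodic_circleMap ξ r 0
  rw [zero_add] at this
  simp only [circleLoop, mul_zero, mul_one, this]

theorem trace_circleLoop (ξ : ℂ) (hr : 0 < r) :
    trace (circleLoop ξ r) = Metric.sphere ξ r := by
  have h2π : 0 < 2 * Real.pi := Real.two_pi_pos
  refine Subset.antisymm ?_ fun z hz => ?_
  · rintro _ ⟨t, _, rfl⟩
    exact circleMap_mem_sphere ξ hr.le _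
  · rw [← abs_of_pos hr, ← image_circleMap_Ioc] at hz
    obtain ⟨θ, hθ, rfl⟩ := hz
    refine ⟨θ / (2 * Real.pi), ⟨div_nonneg hθ.1.le h2π.le, (div_le_one h2π).mpr hθ.2⟩, ?_⟩
    rw [circleLoop, mul_div_cancel₀ _ h2π.ne']

theorem boundedVariationOn_of_lipschitzWith {γ : ℝ → ℂ} {K : NNReal} (h : LipschitzWith K γ) :
    BoundedVariationOn γ (Icc 0 1) := by
  have := h.locallyBoundedVariationOn (Icc 0 1) 0 1 (by simp) (by simp)
  rwa [inter_self] at this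

theorem isRectifiableJordan_circleLoop (ξ : ℂ) (hr : 0 < r) :
    IsRectifiableJordan (circleLoop ξ r) where
  continuousOn := (continuous_circleLoop ξ r).continuousOn
  closed := circleLoop_zero_eq_one ξ r
  injOn := by
    have h2π : 0 < 2 * Real.pi := Real.two_pi_pos
    intro s hs t ht hst
    refine mul_left_cancel₀ h2π.ne' (eq_of_circleMap_eq hr.ne' ?_ hst)
    rw [← mul_sub, abs_mul, abs_of_pos h2π]
    have : |s - t| < 1 := by
      rw [abs_lt]
      constructor <;> linarith [hs.1, hs.2, ht.1, ht.2]
    nlinarith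
  rectifiable := by
    have h : LipschitzWith (Real.toNNReal (2 * Real.pi)) fun t : ℝ => 2 * Real.pi * t := by
      refine LipschitzWith.of_dist_le_mul fun s t => ?_
      rw [Real.coe_toNNReal _ Real.two_pi_pos.le, Real.dist_eq, Real.dist_eq, ← mul_sub, abs_mul,
        abs_of_pos Real.two_pi_pos]
    exact boundedVariationOn_of_lipschitzWith ((lipschitzWith_circleMap ξ r).comp h)

theorem inside_circleLoop_subset (ξ : ℂ) (hr : 0 < r) :
    inside (circleLoop ξ r) ⊆ Metric.ball ξ r := by
  intro z hz
  have htr := trace_circleLoop ξ hr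
  by_contra hzb
  have h1 : z ∉ Metric.sphere ξ r := htr ▸ hz.1
  rw [Metric.mem_ball, not_lt] at hzb
  have h2 : r < dist z ξ := lt_of_le_of_ne hzb fun h => h1 (Metric.mem_sphere.mpr h.symm)
  exact (mem_outside_of_lt_dist (htr ▸ Metric.sphere_subset_closedBall) hr.le h2).2 hz

theorem center_mem_inside_circleLoop (ξ : ℂ) (hr : 0 < r) :
    ξ ∈ inside (circleLoop ξ r) := by
  have htr := trace_circleLoop ξ hr
  have hξ : ξ ∈ (trace (circleLoop ξ r))ᶜ := by
    rw [htr]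
    simp [hr.ne]
  refine ⟨hξ, Metric.isBounded_ball.subset (?_ : _ ⊆ Metric.ball ξ r)⟩
  refine isPreconnected_connectedComponentIn.subset_left_of_subset_union Metric.isOpen_ball
    (Metric.isClosed_closedBall (x := ξ) (ε := r)).isOpen_compl ?_ ?_
    ⟨ξ, mem_connectedComponentIn hξ, Metric.mem_ball_self hr⟩
  · exact disjoint_left.mpr fun y hy hy' => hy' (Metric.ball_subset_closedBall hy)
  · intro y hy
    have hy' := connectedComponentIn_subset _ _ hy
    rw [htr, mem_compl_iff, Metric.mem_sphere] at hy'
    rcases lt_or_gt_of_ne hy' with h | h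
    · exact Or.inl h
    · exact Or.inr fun hc => (not_le.mpr h) (Metric.mem_closedBall.mp hc)

/-- At the centre, the substitution `w ↦ ξ + r * exp w` reduces the integral to that of `1` along
the segment from `0` to `2 π i`. At the other points of the disc the value is the same by
connectedness. -/
theorem isPositivelyOriented_circleLoop (ξ : ℂ) (hr : 0 < r) :
    IsPositivelyOriented (circleLoop ξ r) := by
  have hJ := isRectifiableJordan_circleLoop ξ hr
  have htr := trace_circleLoop ξ hr
  have hr' : (r : ℂ) ≠ 0 := by exact_mod_cast hr.ne'
  have hne : ∀ t ∈ Icc (0 : ℝ) 1, circleLoop ξ r t - ξ ≠ 0 := by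
    intro t _
    simp [circleLoop, circleMap, hr.ne']
  have hcenter : HasStieltjes (circleLoop ξ r) (fun t => (circleLoop ξ r t - ξ)⁻¹)
      (2 * Real.pi * Complex.I) := by
    have hlip : LipschitzWith (Real.toNNReal (2 * Real.pi))
        fun t : ℝ => ((2 * Real.pi * t : ℝ) : ℂ) * Complex.I := by
      refine LipschitzWith.of_dist_le_mul fun s t => ?_
      rw [Real.coe_toNNReal _ Real.two_pi_pos.le, dist_eq_norm, Real.dist_eq, ← sub_mul,
        ← Complex.ofReal_sub, norm_mul, Complex.norm_I, mul_one, Complex.norm_real, ← mul_sub,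
        Real.norm_eq_abs, abs_mul, abs_of_pos Real.two_pi_pos]
    refine HasStieltjes.comp (γ := fun t : ℝ => ((2 * Real.pi * t : ℝ) : ℂ) * Complex.I)
      (f := fun w => ξ + r * Complex.exp w) hlip.continuous.continuousOn
      (boundedVariationOn_of_lipschitzWith hlip) isOpen_univ (fun _ _ => mem_univ _)
      (by fun_prop) ?_ ?_
    · exact (hJ.continuousOn.sub continuousOn_const).inv₀ hne
    · have h1 := hasStieltjes_const (fun t : ℝ => ((2 * Real.pi * t : ℝ) : ℂ) * Complex.I) 1
      have e : (((2 * Real.pi * (1 : ℝ) : ℝ) : ℂ) * Complex.I -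
          ((2 * Real.pi * (0 : ℝ) : ℝ) : ℂ) * Complex.I) * 1 = 2 * Real.pi * Complex.I := by
        push_cast
        ring
      rw [e] at h1
      refine h1.congr fun t _ => ?_
      have hd : HasDerivAt (fun w => ξ + r * Complex.exp w)
          (r * Complex.exp (((2 * Real.pi * t : ℝ) : ℂ) * Complex.I))
          (((2 * Real.pi * t : ℝ) : ℂ) * Complex.I) :=
        ((Complex.hasDerivAt_exp _).const_mul _).const_add _
      rw [hd.deriv, circleLoop, circleMap, add_sub_cancel_left, mul_inv_cancel₀]
      exact mul_ne_zero hr' (Complex.exp_ne_zero _)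
  intro z hz
  have hzb := inside_circleLoop_subset ξ hr hz
  refine (hasContourIntegral_iff (f := fun w => (w - z)⁻¹)).mpr ?_
  refine hasStieltjes_inv_sub_of_isPreconnected hJ.continuousOn hJ.rectifiable hJ.closed
    Metric.isOpen_ball (Metric.isPreconnected_ball (x := ξ) (r := r)) ?_ (Metric.mem_ball_self hr) hzb
    hcenter
  rw [htr]
  exact fun y hy hy' => (ne_of_lt (Metric.mem_ball.mp hy)) (Metric.mem_sphere.mp hy')

end Circle

/-- Small circles are admissible. -/
theorem exists_isAdmissible {m : ℕ} {D : Fin m → Set ℂ} (hD : ∀ q, IsOpen (D q)) {ξ : Fin m → ℂ}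
    (hξ : ∀ q, ξ q ∈ D q) : ∃ Γ, IsAdmissible D ξ Γ := by
  have hex : ∀ q, ∃ r > 0, Metric.closedBall (ξ q) r ⊆ D q ∧
      ∀ l, ξ l ∉ Metric.sphere (ξ q) r := by
    intro q
    obtain ⟨ρ, hρ, hρD⟩ := Metric.nhds_basis_closedBall.mem_iff.mp ((hD q).mem_nhds (hξ q))
    have h1 : ∀ᶠ r in 𝓝[>] (0 : ℝ), ∀ l, ξ l ∉ Metric.sphere (ξ q) r := by
      rw [eventually_all]
      intro l
      rcases eq_or_ne (dist (ξ l) (ξ q)) 0 with h0 | h0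
      · filter_upwards [self_mem_nhdsWithin] with r hr
        rw [Metric.mem_sphere, h0]
        exact (ne_of_gt (mem_Ioi.mp hr)).symm
      · have : 0 < dist (ξ l) (ξ q) := lt_of_le_of_ne dist_nonneg h0.symm
        filter_upwards [Ioo_mem_nhdsGT this] with r hr
        rw [Metric.mem_sphere]
        exact hr.2.ne'
    obtain ⟨r, hr, hrρ⟩ := (h1.and (Ioc_mem_nhdsGT hρ)).exists
    exact ⟨r, hrρ.1, (Metric.closedBall_subset_closedBall hrρ.2).trans hρD, hr⟩
  choose r hr hrD hrl using hex
  refine ⟨fun q => circleLoop (ξ q) (r q), ?_, ?_, ?_, ?_, ?_, ?_⟩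
  · exact fun q => isRectifiableJordan_circleLoop _ (hr q)
  · exact fun q => isPositivelyOriented_circleLoop _ (hr q)
  · intro q
    rw [trace_circleLoop _ (hr q)]
    exact Metric.sphere_subset_closedBall.trans (hrD q)
  · exact fun q => (inside_circleLoop_subset _ (hr q)).trans
      (Metric.ball_subset_closedBall.trans (hrD q))
  · exact fun q => center_mem_inside_circleLoop _ (hr q)
  · intro q l _
    rw [trace_circleLoop _ (hr q)]
    exact hrl q l

/-! ### Functions that factor through a linear functional -/

/-- A continuous function on a domain that is convex along the kernel of `ℓ`, all of whose
directional derivatives are given by `v ↦ ℓ v * c`, is a holomorphic function of `ℓ`. -/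
theorem exists_differentiableOn_comp {E : Type*} [NormedAddCommGroup E] [NormedSpace ℝ E]
    [FiniteDimensional ℝ E] {Ω : Set E} (hΩ : IsOpen Ω) (ℓ : E →ₗ[ℝ] ℂ)
    (hsurj : Function.Surjective ℓ)
    (hconv : ∀ p ∈ Ω, ∀ q ∈ Ω, ℓ p = ℓ q → segment ℝ p q ⊆ Ω) {U : E → ℂ} (hU : ContinuousOn U Ω)
    (hd : ∀ p ∈ Ω, ∃ c : ℂ, ∀ v, Tendsto (fun ε : ℝ => ε⁻¹ • (U (p + ε • v) - U p)) (𝓝[>] 0)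
      (𝓝 (ℓ v * c))) :
    ∃ F : ℂ → ℂ, DifferentiableOn ℂ F (ℓ '' Ω) ∧ ∀ p ∈ Ω, U p = F (ℓ p) := by
  -- Along the segment the right derivative of `U` is `ℓ (q - p) * c = 0`, and a continuous function
  -- with zero right derivative is constant.
  have hfib : ∀ p ∈ Ω, ∀ q ∈ Ω, ℓ p = ℓ q → U p = U q := by
    intro p hp q hq hpq
    have hseg : ∀ s ∈ Icc (0 : ℝ) 1, p + s • (q - p) ∈ Ω := fun s hs =>
      hconv p hp q hq hpq (segment_eq_image' ℝ p q ▸ mem_image_of_mem _ hs)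
    have hconst := constant_of_has_deriv_right_zero (f := fun s : ℝ => U (p + s • (q - p)))
      (a := 0) (b := 1) (hU.comp (by fun_prop) hseg) ?_ 1 (by simp)
    · simpa using hconst.symm
    · intro s hs
      obtain ⟨c, hc⟩ := hd _ (hseg s ⟨hs.1, hs.2.le⟩)
      have h1 := hc (q - p)
      rw [map_sub, hpq, sub_self, zero_mul] at h1
      rw [← hasDerivWithinAt_Ioi_iff_Ici, hasDerivWithinAt_iff_tendsto_slope' (by simp)]
      have h2 : Tendsto (fun y : ℝ => y - s) (𝓝[>] s) (𝓝[>] 0) := by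
        refine tendsto_nhdsWithin_iff.mpr ⟨?_, ?_⟩
        · have : Continuous fun y : ℝ => y - s := by fun_prop
          simpa using (this.tendsto s).mono_left nhdsWithin_le_nhds
        · filter_upwards [self_mem_nhdsWithin] with y hy
          exact mem_Ioi.mpr (sub_pos.mpr (mem_Ioi.mp hy))
      refine (h1.comp h2).congr fun y => ?_
      simp only [Function.comp_apply, slope_def_module]
      congr 3
      rw [add_assoc, ← add_smul, add_sub_cancel]
  have hopen : IsOpenMap ℓ := by
    have := (LinearMap.toContinuousLinearMap ℓ).isOpenMap hsurj
    simpa using this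
  -- Any preimage in `Ω` serves, as `U` is constant on the fibres. Continuity of `F` comes from `ℓ`
  -- being an open map.
  set F : ℂ → ℂ := fun z => U (Function.invFunOn ℓ Ω z) with hF
  have hFU : ∀ p ∈ Ω, F (ℓ p) = U p := fun p hp =>
    hfib _ (Function.invFunOn_mem ⟨p, hp, rfl⟩) _ hp (Function.invFunOn_eq ⟨p, hp, rfl⟩)
  refine ⟨F, ?_, fun p hp => (hFU p hp).symm⟩
  refine differentiableOn_of_hasGateauxDeriv (hopen Ω hΩ) ?_ ?_
  · rintro _ ⟨p, hp, rfl⟩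
    refine ContinuousAt.continuousWithinAt fun V hV => ?_
    rw [hFU p hp] at hV
    have h1 : Ω ∩ U ⁻¹' V ∈ 𝓝 p :=
      inter_mem (hΩ.mem_nhds hp) ((hU.continuousAt (hΩ.mem_nhds hp)) hV)
    rw [mem_map]
    filter_upwards [hopen.image_mem_nhds h1]
    rintro _ ⟨q, hq, rfl⟩
    rw [mem_preimage, hFU q hq.1]
    exact hq.2
  · rintro _ ⟨p, hp, rfl⟩
    obtain ⟨c, hc⟩ := hd p hp
    refine ⟨c, fun h => ?_⟩
    obtain ⟨v, rfl⟩ := hsurj h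
    refine (hc v).congr' ?_
    have hcont : Tendsto (fun ε : ℝ => p + ε • v) (𝓝[>] 0) (𝓝 p) := by
      have : Continuous fun ε : ℝ => p + ε • v := by fun_prop
      simpa using (this.tendsto 0).mono_left nhdsWithin_le_nhds
    filter_upwards [hcont (hΩ.mem_nhds hp)] with ε hε
    rw [← map_smul, ← map_add, hFU _ hε, hFU p hp]

/-! ### Triangular multiplication and the nilpotent filtration -/

section Algebra

variable {A : Type*} [CommRing A] [Algebra ℂ A] {m d : ℕ}
  {b : Module.Basis (Fin m ⊕ Fin d) ℂ A} {w : Fin d → Fin m}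

/-- The index of the only idempotent that does not annihilate the basis vector `b i`. -/
def idemIndex (w : Fin d → Fin m) : Fin m ⊕ Fin d → Fin m := Sum.elim id w

theorem IsCartanBasis.idem_mul (hb : IsCartanBasis b w) (r : Fin m) (i : Fin m ⊕ Fin d) :
    b (Sum.inl r) * b i = if r = idemIndex w i then b i else 0 := by
  rcases i with u | s
  · rw [hb.idem_mul_idem]
    by_cases h : r = u
    · subst h
      simp [idemIndex]
    · simp [idemIndex, h]
  · exact hb.idem_mul_nil r s

/-- The sum fixes every basis vector, so it acts as the unit. -/
theorem IsCartanBasis.sum_idem (hb : IsCartanBasis b w) : ∑ u, b (Sum.inl u) = 1 := by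
  have h : ∀ a : A, (∑ u, b (Sum.inl u)) * a = a := by
    intro a
    have hl : LinearMap.mulLeft ℂ (∑ u, b (Sum.inl u)) = LinearMap.id := by
      refine b.ext fun i => ?_
      simp [Finset.sum_mul, hb.idem_mul]
    simpa using LinearMap.congr_fun hl a
  simpa using h 1

theorem IsCartanBasis.functional_one (hb : IsCartanBasis b w) (u : Fin m) :
    functional b u 1 = 1 := by
  classical
  simp [functional, ← hb.sum_idem, Finsupp.single_apply]

theorem IsCartanBasis.repr_one_inr (hb : IsCartanBasis b w) (s : Fin d) :
    b.repr 1 (Sum.inr s) = 0 := by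
  simp [← hb.sum_idem]

theorem repr_mul_eq_sum (x y : A) (j : Fin m ⊕ Fin d) :
    b.repr (x * y) j = ∑ i, ∑ k, b.repr x i * b.repr y k * b.repr (b i * b k) j := by
  conv_lhs => rw [← b.sum_repr x, ← b.sum_repr y, Finset.sum_mul_sum]
  simp only [map_sum, smul_mul_smul_comm, map_smul, Finsupp.finsetSum_apply, Finsupp.smul_apply,
    smul_eq_mul]

/-- The functionals `f_u` are multiplicative. -/
theorem IsCartanBasis.functional_mul (hb : IsCartanBasis b w) (u : Fin m) (x y : A) :
    functional b u (x * y) = functional b u x * functional b u y := by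
  classical
  have h1 : ∀ r (k : Fin d), b.repr (b (Sum.inl r) * b (Sum.inr k)) (Sum.inl u) = 0 := by
    intro r k
    rw [hb.idem_mul_nil]
    split_ifs <;> simp
  have h2 : ∀ r k : Fin m, b.repr (b (Sum.inl r) * b (Sum.inl k)) (Sum.inl u) =
      if r = k then (if r = u then 1 else 0) else 0 := by
    intro r k
    rw [hb.idem_mul_idem]
    split_ifs <;> simp_all
  simp only [functional, Module.Basis.coord_apply]
  rw [repr_mul_eq_sum]
  simp only [Fintype.sum_sum_type]
  simp [h1, h2, hb.nil_mul_nil_left, mul_comm (b (Sum.inr _)) (b (Sum.inl _))]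

/-- The span of the nilpotent basis vectors with (zero based) position at least `k`. -/
def nilFiltration (b : Module.Basis (Fin m ⊕ Fin d) ℂ A) (k : ℕ) : Submodule ℂ A where
  carrier := {a | (∀ u, b.repr a (Sum.inl u) = 0) ∧
    ∀ s : Fin d, (s : ℕ) < k → b.repr a (Sum.inr s) = 0}
  add_mem' := by
    rintro x y ⟨hx1, hx2⟩ ⟨hy1, hy2⟩
    exact ⟨fun u => by simp [hx1, hy1], fun s hs => by simp [hx2 s hs, hy2 s hs]⟩
  zero_mem' := by simp
  smul_mem' := by
    rintro c x ⟨hx1, hx2⟩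
    exact ⟨fun u => by simp [hx1], fun s hs => by simp [hx2 s hs]⟩

theorem eq_zero_of_mem_nilFiltration {a : A} (ha : a ∈ nilFiltration b d) : a = 0 := by
  refine b.ext_elem fun i => ?_
  rcases i with u | s
  · simpa using ha.1 u
  · simpa using ha.2 s s.2

theorem nilFiltration_mono {k l : ℕ} (h : k ≤ l) : nilFiltration b l ≤ nilFiltration b k :=
  fun _ ha => ⟨ha.1, fun s hs => ha.2 s (hs.trans_le h)⟩

theorem basis_inr_mem_nilFiltration (s : Fin d) : b (Sum.inr s) ∈ nilFiltration b s := by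
  classical
  refine ⟨fun u => by simp, fun t ht => ?_⟩
  have : s ≠ t := fun h => by simp [h] at ht
  simp [this]

/-- A product of two nilpotents has only coordinates beyond both factors, so up to position `k`
inclusive only the idempotent part of `h` acts on `a`, by a scalar. The inclusive bound covers the
first coordinate of `a` that may be nonzero, the one extracted in the decomposition. -/
theorem IsCartanBasis.repr_mul_inr (hb : IsCartanBasis b w) {k : ℕ} {a : A}
    (ha : a ∈ nilFiltration b k) (h : A) {t : Fin d} (ht : (t : ℕ) ≤ k) :
    b.repr (h * a) (Sum.inr t) = functional b (w t) h * b.repr a (Sum.inr t) := by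
  classical
  have h1 : ∀ r s, b.repr (b (Sum.inl r) * b (Sum.inr s)) (Sum.inr t) =
      if r = w s then (if s = t then 1 else 0) else 0 := by
    intro r s
    rw [hb.idem_mul_nil]
    split_ifs <;> simp_all
  have h2 : ∀ r s, b.repr a (Sum.inr s) * b.repr (b (Sum.inr r) * b (Sum.inr s)) (Sum.inr t) = 0 := by
    intro r s
    by_cases hs : (s : ℕ) < k
    · rw [ha.2 s hs, zero_mul]
    · rw [hb.nil_mul_nil_right, mul_zero]
      exact le_max_of_le_right (Fin.le_def.mpr (by omega))
  rw [repr_mul_eq_sum]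
  simp only [Fintype.sum_sum_type, ha.1, mul_assoc, h2]
  simp only [h1, zero_mul, mul_zero, Finset.sum_const_zero, zero_add, add_zero]
  rw [Finset.sum_comm]
  simp [functional]

theorem IsCartanBasis.mul_mem_nilFiltration (hb : IsCartanBasis b w) {k : ℕ} {a : A}
    (ha : a ∈ nilFiltration b k) (h : A) : h * a ∈ nilFiltration b k := by
  refine ⟨fun u => ?_, fun s hs => ?_⟩
  · have := hb.functional_mul u h a
    simp only [functional, Module.Basis.coord_apply, ha.1, mul_zero] at this
    exact this
  · rw [hb.repr_mul_inr ha h hs.le, ha.2 s hs, mul_zero]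

theorem IsCartanBasis.nil_mul_mem_nilFiltration (hb : IsCartanBasis b w) {k : ℕ} {x a : A}
    (hx : x ∈ nilFiltration b 0) (ha : a ∈ nilFiltration b k) : x * a ∈ nilFiltration b (k + 1) := by
  refine ⟨(hb.mul_mem_nilFiltration ha x).1, fun s hs => ?_⟩
  rw [hb.repr_mul_inr ha x (Nat.lt_succ_iff.mp hs)]
  have : functional b (w s) x = 0 := hx.1 _
  rw [this, zero_mul]

theorem IsCartanBasis.pow_mul_mem_nilFiltration (hb : IsCartanBasis b w) {k : ℕ} {x a : A}
    (hx : x ∈ nilFiltration b 0) (ha : a ∈ nilFiltration b k) (l : ℕ) :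
    x ^ l * a ∈ nilFiltration b (k + l) := by
  induction l with
  | zero => simpa using ha
  | succ l ih =>
    rw [pow_succ', mul_assoc]
    exact hb.nil_mul_mem_nilFiltration hx ih

theorem IsCartanBasis.pow_succ_mem_nilFiltration (hb : IsCartanBasis b w) {x : A}
    (hx : x ∈ nilFiltration b 0) (l : ℕ) : x ^ (l + 1) ∈ nilFiltration b l := by
  have := hb.pow_mul_mem_nilFiltration hx hx l
  rwa [zero_add, ← pow_succ] at this

/-- The nilpotent part of an element. -/
noncomputable def nilPart (b : Module.Basis (Fin m ⊕ Fin d) ℂ A) : A →ₗ[ℂ] A :=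
  ∑ s, (b.coord (Sum.inr s)).smulRight (b (Sum.inr s))

theorem nilPart_apply (a : A) :
    nilPart b a = ∑ s, b.repr a (Sum.inr s) • b (Sum.inr s) := by
  simp [nilPart]

theorem repr_nilPart_inr (a : A) (s : Fin d) :
    b.repr (nilPart b a) (Sum.inr s) = b.repr a (Sum.inr s) := by
  classical
  simp [nilPart_apply, Finsupp.single_apply]

theorem nilPart_mem (a : A) : nilPart b a ∈ nilFiltration b 0 := by
  refine ⟨fun u => ?_, fun s hs => absurd hs (Nat.not_lt_zero _)⟩
  simp [nilPart_apply]

/-- Of the idempotent part of `a`, only the component with index `idemIndex w i` survives against `b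
i`. -/
theorem IsCartanBasis.mul_basis (hb : IsCartanBasis b w) (a : A) (i : Fin m ⊕ Fin d) :
    a * b i = functional b (idemIndex w i) a • b i + nilPart b a * b i := by
  conv_lhs => rw [← b.sum_repr a, Fintype.sum_sum_type]
  rw [add_mul, ← nilPart_apply]
  congr 1
  simp [Finset.sum_mul, hb.idem_mul, functional]

end Algebra

/-! ### Principal extensions of holomorphic functions -/

section Extension

variable {A : Type*} [CommRing A] [Algebra ℂ A] {m d : ℕ}
  {b : Module.Basis (Fin m ⊕ Fin d) ℂ A} {w : Fin d → Fin m}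

/-- The principal extension of a holomorphic function `F` of one variable, multiplied by the basis
vector `b i`: the value at `a` is the Taylor expansion of `F` about `f_u(a)` at the nilpotent part
of `a`, where `u` is the index of the idempotent that does not annihilate `b i`. -/
noncomputable def principalExtension (b : Module.Basis (Fin m ⊕ Fin d) ℂ A) (w : Fin d → Fin m)
    (F : ℂ → ℂ) (i : Fin m ⊕ Fin d) (a : A) : A :=
  ∑ k ∈ Finset.range (d + 1),
    ((1 / (k.factorial : ℂ)) * iteratedDeriv k F (functional b (idemIndex w i) a)) •
      (nilPart b a ^ k * b i)

theorem principalExtension_eq (F : ℂ → ℂ) (i : Fin m ⊕ Fin d) (a : A) :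
    principalExtension b w F i a = ∑ k ∈ Finset.range d,
      ((1 / ((k + 1).factorial : ℂ)) *
        iteratedDeriv (k + 1) F (functional b (idemIndex w i) a)) • (nilPart b a ^ (k + 1) * b i) +
      F (functional b (idemIndex w i) a) • b i := by
  rw [principalExtension, Finset.sum_range_succ']
  simp

theorem principalExtension_zero (i : Fin m ⊕ Fin d) (a : A) :
    principalExtension b w (fun _ => 0) i a = 0 := by
  refine Finset.sum_eq_zero fun k _ => ?_
  have : iteratedDeriv k (fun _ : ℂ => (0 : ℂ)) = fun _ => 0 := by
    ext
    simp
  rw [this]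
  simp

theorem IsCartanBasis.principalExtension_inl_sub_mem (hb : IsCartanBasis b w) (F : ℂ → ℂ)
    (u : Fin m) (a : A) :
    principalExtension b w F (Sum.inl u) a - F (functional b u a) • b (Sum.inl u) ∈
      nilFiltration b 0 := by
  rw [principalExtension_eq]
  simp only [idemIndex, Sum.elim_inl, id, add_sub_cancel_right]
  refine Submodule.sum_mem _ fun k _ => Submodule.smul_mem _ _ ?_
  rw [mul_comm]
  exact hb.mul_mem_nilFiltration (nilFiltration_mono (Nat.zero_le _)
    (hb.pow_succ_mem_nilFiltration (nilPart_mem a) k)) _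

/-- Every factor `N` pushes `b (Sum.inr s)` at least one level deeper, so only the term `k = 0`
reaches level `s`. -/
theorem IsCartanBasis.principalExtension_inr_sub_mem (hb : IsCartanBasis b w) (F : ℂ → ℂ)
    (s : Fin d) (a : A) :
    principalExtension b w F (Sum.inr s) a - F (functional b (w s) a) • b (Sum.inr s) ∈
      nilFiltration b (s + 1) := by
  rw [principalExtension_eq]
  simp only [idemIndex, Sum.elim_inr, add_sub_cancel_right]
  refine Submodule.sum_mem _ fun k _ => Submodule.smul_mem _ _ ?_
  exact nilFiltration_mono (by omega)
    (hb.pow_mul_mem_nilFiltration (nilPart_mem a) (basis_inr_mem_nilFiltration s) (k + 1))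

/-- Testing against a linear functional `L` avoids any topology on `A`. For `k = 0` the truncated
exponent `k - 1` is harmless because of the factor `k`. -/
theorem hasDerivAt_map_pow_mul (L : A →ₗ[ℂ] ℂ) (N M x : A) (k : ℕ) :
    HasDerivAt (fun ε : ℂ => L ((N + ε • M) ^ k * x)) (k * L (N ^ (k - 1) * (M * x))) 0 := by
  induction k generalizing x with
  | zero => simpa using hasDerivAt_const (0 : ℂ) (L x)
  | succ k ih =>
    have h := (ih (N * x)).fun_add ((hasDerivAt_id (0 : ℂ)).fun_mul (ih (M * x)))
    have e : (fun ε : ℂ => L ((N + ε • M) ^ (k + 1) * x)) = fun ε =>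
        L ((N + ε • M) ^ k * (N * x)) + id ε * L ((N + ε • M) ^ k * (M * x)) := by
      ext ε
      have e1 : (N + ε • M) ^ (k + 1) * x =
          (N + ε • M) ^ k * (N * x) + ε • ((N + ε • M) ^ k * (M * x)) := by
        rw [← mul_smul_comm, ← smul_mul_assoc]
        ring
      rw [e1, map_add, map_smul, smul_eq_mul, id]
    rw [e]
    refine h.congr_deriv ?_
    rcases k with _ | k
    · simp
    · have h2 : N ^ k * (M * (N * x)) = N ^ (k + 1) * (M * x) := by ring
      simp only [Nat.add_sub_cancel, h2, id, zero_smul, add_zero]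
      push_cast
      ring

theorem differentiableOn_iteratedDeriv {F : ℂ → ℂ} {D : Set ℂ} (hD : IsOpen D)
    (hF : DifferentiableOn ℂ F D) (k : ℕ) : DifferentiableOn ℂ (iteratedDeriv k F) D := by
  induction k with
  | zero => simpa using hF
  | succ k ih =>
    rw [iteratedDeriv_succ]
    exact ih.deriv hD

/-- The principal extension has the directional derivatives of a monogenic function. -/
theorem IsCartanBasis.hasDerivAt_principalExtension (hb : IsCartanBasis b w) {F : ℂ → ℂ}
    {D : Set ℂ} (hD : IsOpen D) (hF : DifferentiableOn ℂ F D) (i : Fin m ⊕ Fin d) {a : A} (h : A)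
    (ha : functional b (idemIndex w i) a ∈ D) (L : A →ₗ[ℂ] ℂ) :
    HasDerivAt (fun ε : ℂ => L (principalExtension b w F i (a + ε • h)))
      (L (h * principalExtension b w (deriv F) i a)) 0 := by
  set ξ := functional b (idemIndex w i) a with hξ
  set η := functional b (idemIndex w i) h with hη
  set N := nilPart b a with hN
  set M := nilPart b h with hM
  have hG : ∀ k, HasDerivAt (fun ε : ℂ => iteratedDeriv k F (ξ + ε * η))
      (iteratedDeriv (k + 1) F ξ * η) 0 := by
    intro k
    have h1 : HasDerivAt (iteratedDeriv k F) (iteratedDeriv (k + 1) F ξ) (ξ + 0 * η) := by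
      rw [iteratedDeriv_succ, zero_mul, add_zero]
      exact ((differentiableOn_iteratedDeriv hD hF k).differentiableAt (hD.mem_nhds ha)).hasDerivAt
    have h2 : HasDerivAt (fun ε : ℂ => ξ + ε * η) η 0 := by
      simpa using ((hasDerivAt_id (0 : ℂ)).mul_const η).const_add ξ
    exact h1.comp (0 : ℂ) h2
  have hfun : (fun ε : ℂ => L (principalExtension b w F i (a + ε • h))) = fun ε =>
      ∑ k ∈ Finset.range (d + 1), (1 / (k.factorial : ℂ)) *
        (iteratedDeriv k F (ξ + ε * η) * L ((N + ε • M) ^ k * b i)) := by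
    ext ε
    simp only [principalExtension, map_sum, map_smul, map_add, smul_eq_mul, mul_assoc, hξ, hη, hN,
      hM]
  -- The `d + 1` nilpotent factors exhaust the filtration. This removes the last term when the index
  -- of the second sum is shifted by one below.
  have hlast : N ^ d * (M * b i) = 0 := by
    refine eq_zero_of_mem_nilFiltration (b := b) ?_
    have h1 := hb.pow_mul_mem_nilFiltration (nilPart_mem a)
      (hb.mul_mem_nilFiltration (nilPart_mem h) (b i)) d
    rwa [zero_add, mul_comm (b i)] at h1
  rw [hfun]
  refine (HasDerivAt.fun_sum fun k _ =>
    ((hG k).fun_mul (hasDerivAt_map_pow_mul L N M (b i) k)).const_mul _).congr_deriv ?_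
  simp only [zero_mul, zero_smul, add_zero]
  -- On `b i` multiplication by `h` is `η + M`: the part `η` accounts for the derivatives of the
  -- coefficients, the part `M` for those of the powers of `N`.
  have hterm : ∀ k : ℕ, L (h * (N ^ k * b i)) =
      η * L (N ^ k * b i) + L (N ^ k * (M * b i)) := by
    intro k
    have : h * (N ^ k * b i) = N ^ k * (h * b i) := by ring
    rw [this, hb.mul_basis, mul_add, map_add, mul_smul_comm, map_smul, smul_eq_mul]
  rw [principalExtension, ← hξ, ← hN, Finset.mul_sum, map_sum]
  simp only [mul_smul_comm, map_smul, smul_eq_mul, hterm, ← iteratedDeriv_succ', mul_add,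
    Finset.sum_add_distrib]
  congr 1
  · exact Finset.sum_congr rfl fun k _ => by ring
  · rw [Finset.sum_range_succ', Finset.sum_range_succ _ d, hlast]
    simp only [map_zero, mul_zero, add_zero, Nat.cast_zero, zero_mul, Nat.add_sub_cancel]
    refine Finset.sum_congr rfl fun k _ => ?_
    rw [Nat.factorial_succ]
    have h1 : (k.factorial : ℂ) ≠ 0 := by exact_mod_cast k.factorial_ne_zero
    have h2 : (k : ℂ) + 1 ≠ 0 := by exact_mod_cast k.succ_ne_zero
    push_cast
    field_simp

theorem continuous_map_sum_pow_mul {X ι : Type*} [TopologicalSpace X] [Fintype ι] {c : ι → X → ℂ}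
    (hc : ∀ i, Continuous (c i)) (v : ι → A) (L : A →ₗ[ℂ] ℂ) (x : A) (k : ℕ) :
    Continuous fun p => L ((∑ i, c i p • v i) ^ k * x) := by
  induction k generalizing x with
  | zero => simpa using continuous_const
  | succ k ih =>
    have e : (fun p => L ((∑ i, c i p • v i) ^ (k + 1) * x)) = fun p =>
        ∑ i, c i p * L ((∑ i, c i p • v i) ^ k * (v i * x)) := by
      ext p
      rw [pow_succ, mul_assoc, Finset.sum_mul, Finset.mul_sum, map_sum]
      refine Finset.sum_congr rfl fun i _ => ?_
      rw [smul_mul_assoc, mul_smul_comm, map_smul, smul_eq_mul]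
    rw [e]
    exact continuous_finsetSum _ fun i _ => (hc i).mul (ih _)

end Extension

/-! ### The variable `ζ` in coordinates and the coefficients `Q_{k,s}` -/

section Zeta

variable {A : Type*} [CommRing A] [Algebra ℂ A] {m d : ℕ}
  {b : Module.Basis (Fin m ⊕ Fin d) ℂ A} {w : Fin d → Fin m} {e₂ e₃ : A}

theorem zeta_add_smul (p v : Fin 3 → ℝ) (ε : ℝ) :
    zeta e₂ e₃ (p + ε • v) = zeta e₂ e₃ p + ε • zeta e₂ e₃ v := by
  simp only [zeta, Pi.add_apply, Pi.smul_apply, smul_eq_mul, add_smul, smul_add, mul_smul]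
  abel

/-- The functional `f_u` in the coordinates of `ℝ³`. -/
noncomputable def coordFunctional (b : Module.Basis (Fin m ⊕ Fin d) ℂ A) (e₂ e₃ : A) (u : Fin m) :
    (Fin 3 → ℝ) →ₗ[ℝ] ℂ where
  toFun p := functional b u (zeta e₂ e₃ p)
  map_add' p v := by
    have := zeta_add_smul (e₂ := e₂) (e₃ := e₃) p v 1
    rw [one_smul, one_smul] at this
    rw [this, map_add]
  map_smul' r p := by
    have := zeta_add_smul (e₂ := e₂) (e₃ := e₃) 0 p r
    have h0 : zeta e₂ e₃ 0 = 0 := by simp [zeta]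
    rw [h0, zero_add, zero_add] at this
    rw [this, ← Complex.coe_smul, map_smul, RingHom.id_apply, Complex.coe_smul]

theorem coordFunctional_apply (u : Fin m) (p : Fin 3 → ℝ) :
    coordFunctional b e₂ e₃ u p = functional b u (zeta e₂ e₃ p) := rfl

theorem planeDomain_eq (Ω : Set (Fin 3 → ℝ)) (u : Fin m) :
    planeDomain b e₂ e₃ Ω u = coordFunctional b e₂ e₃ u '' Ω := by
  rw [planeDomain, omegaZeta, image_image]
  rfl

theorem coordFunctional_surjective
    (hsurj : ∀ u : Fin m, functional b u '' E3 e₂ e₃ = Set.univ) (u : Fin m) :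
    Function.Surjective (coordFunctional b e₂ e₃ u) := by
  intro z
  have : z ∈ functional b u '' E3 e₂ e₃ := hsurj u ▸ mem_univ z
  obtain ⟨_, ⟨p, rfl⟩, hp⟩ := this
  exact ⟨p, hp⟩

theorem isOpen_planeDomain (hsurj : ∀ u : Fin m, functional b u '' E3 e₂ e₃ = Set.univ)
    {Ω : Set (Fin 3 → ℝ)} (hΩ : IsOpen Ω) (u : Fin m) : IsOpen (planeDomain b e₂ e₃ Ω u) := by
  rw [planeDomain_eq]
  have := (LinearMap.toContinuousLinearMap (coordFunctional b e₂ e₃ u)).isOpenMap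
    (coordFunctional_surjective hsurj u)
  exact this Ω hΩ

theorem mem_planeDomain {Ω : Set (Fin 3 → ℝ)} {p : Fin 3 → ℝ} (hp : p ∈ Ω) (u : Fin m) :
    functional b u (zeta e₂ e₃ p) ∈ planeDomain b e₂ e₃ Ω u :=
  mem_image_of_mem _ (mem_image_of_mem _ hp)

theorem IsCartanBasis.mem_lineL (hb : IsCartanBasis b w) {u : Fin m} {v : Fin 3 → ℝ}
    (hv : coordFunctional b e₂ e₃ u v = 0) : v ∈ lineL b e₂ e₃ u := by
  rw [coordFunctional_apply, zeta, map_add, map_add] at hv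
  simp only [← Complex.coe_smul, map_smul, hb.functional_one, smul_eq_mul, mul_one] at hv
  have h1 := congrArg Complex.re hv
  have h2 := congrArg Complex.im hv
  simp [functional] at h1 h2
  exact ⟨h1, h2⟩

theorem IsCartanBasis.repr_zeta_inr (hb : IsCartanBasis b w) (p : Fin 3 → ℝ) (s : Fin d) :
    b.repr (zeta e₂ e₃ p) (Sum.inr s) = coeffT b e₂ e₃ p s := by
  rw [zeta, coeffT]
  simp only [← Complex.coe_smul, map_add, map_smul, Finsupp.add_apply, Finsupp.smul_apply,
    hb.repr_one_inr, smul_eq_mul, mul_zero, zero_add]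

theorem IsCartanBasis.nilPart_zeta (hb : IsCartanBasis b w) (p : Fin 3 → ℝ) :
    nilPart b (zeta e₂ e₃ p) = ∑ s, coeffT b e₂ e₃ p s • b (Sum.inr s) := by
  simp only [nilPart_apply, hb.repr_zeta_inr]

theorem continuous_coordFunctional (u : Fin m) : Continuous (coordFunctional b e₂ e₃ u) :=
  LinearMap.continuous_of_finiteDimensional _

theorem IsCartanBasis.continuousOn_principalExtension (hb : IsCartanBasis b w)
    (hsurj : ∀ u : Fin m, functional b u '' E3 e₂ e₃ = Set.univ)
    {Ω : Set (Fin 3 → ℝ)} (hΩ : IsOpen Ω) {F : ℂ → ℂ} (i : Fin m ⊕ Fin d)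
    (hF : DifferentiableOn ℂ F (planeDomain b e₂ e₃ Ω (idemIndex w i))) (L : A →ₗ[ℂ] ℂ) :
    ContinuousOn (fun p => L (principalExtension b w F i (zeta e₂ e₃ p))) Ω := by
  simp only [principalExtension, map_sum, map_smul, smul_eq_mul]
  refine continuousOn_finsetSum _ fun k _ => ContinuousOn.mul (continuousOn_const.mul ?_) ?_
  · refine (differentiableOn_iteratedDeriv (isOpen_planeDomain hsurj hΩ _) hF k).continuousOn.comp
      (f := fun p => functional b (idemIndex w i) (zeta e₂ e₃ p))
      (continuous_coordFunctional _).continuousOn fun p hp => mem_planeDomain hp _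
  · simp only [hb.nilPart_zeta]
    refine (continuous_map_sum_pow_mul (fun s => ?_) _ L (b i) k).continuousOn
    unfold coeffT
    fun_prop

/-- The coefficients of the powers of the nilpotent part of `ζ`. -/
theorem IsCartanBasis.repr_nilPart_zeta_pow (hb : IsCartanBasis b w) (p : Fin 3 → ℝ) (k : ℕ)
    (s : Fin d) :
    b.repr (nilPart b (zeta e₂ e₃ p) ^ (k + 1)) (Sum.inr s) = coeffQ b e₂ e₃ p (k + 2) s := by
  induction k generalizing s with
  | zero => rw [zero_add, pow_one, repr_nilPart_inr, hb.repr_zeta_inr]; rfl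
  | succ k ih =>
    rw [pow_succ, repr_mul_eq_sum]
    simp only [Fintype.sum_sum_type, (hb.pow_succ_mem_nilFiltration (nilPart_mem _) k).1,
      (nilPart_mem (b := b) (zeta e₂ e₃ p)).1, ih, repr_nilPart_inr, hb.repr_zeta_inr, zero_mul,
      mul_zero, Finset.sum_const_zero, zero_add]
    rw [coeffQ, Finset.sum_filter]
    refine Finset.sum_congr rfl fun r _ => ?_
    split_ifs with hr
    · rw [coeffB, Finset.mul_sum, Finset.sum_filter]
      refine Finset.sum_congr rfl fun q _ => ?_
      split_ifs with hq
      · rw [structConst, mul_assoc]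
      · rw [hb.nil_mul_nil_right _ _ _ (le_max_of_le_right (not_lt.mp hq)), mul_zero]
    · refine Finset.sum_eq_zero fun q _ => ?_
      rw [hb.nil_mul_nil_right _ _ _ (le_max_of_le_left (not_lt.mp hr)), mul_zero]

theorem IsCartanBasis.nilPart_zeta_pow (hb : IsCartanBasis b w) (p : Fin 3 → ℝ) (k : ℕ) :
    nilPart b (zeta e₂ e₃ p) ^ (k + 1) =
      ∑ s, coeffQ b e₂ e₃ p (k + 2) s • b (Sum.inr s) := by
  conv_lhs => rw [← b.sum_repr (nilPart b (zeta e₂ e₃ p) ^ (k + 1)), Fintype.sum_sum_type]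
  simp only [(hb.pow_succ_mem_nilFiltration (nilPart_mem _) k).1, hb.repr_nilPart_zeta_pow,
    zero_smul, Finset.sum_const_zero, zero_add]

theorem IsCartanBasis.coeffQ_eq_zero (hb : IsCartanBasis b w) (p : Fin 3 → ℝ) {k : ℕ} {s : Fin d}
    (h : (s : ℕ) < k) : coeffQ b e₂ e₃ p (k + 2) s = 0 := by
  rw [← hb.repr_nilPart_zeta_pow]
  exact (hb.pow_succ_mem_nilFiltration (nilPart_mem _) k).2 s h

/-- The index is shifted by two, and the additional terms on the right vanish: `N ^ (k + 1)` has no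
coordinates at positions before `k`, so `Q_{k+2,s} = 0` for `s < k`. -/
theorem IsCartanBasis.sum_coeffQ (hb : IsCartanBasis b w) (p : Fin 3 → ℝ) (s : Fin d) (F : ℂ → ℂ)
    (z : ℂ) :
    ∑ k ∈ Finset.Icc 2 ((s : ℕ) + 2), (1 / ((k - 1).factorial : ℂ)) * coeffQ b e₂ e₃ p k s *
      iteratedDeriv (k - 1) F z =
    ∑ k ∈ Finset.range d, (1 / ((k + 1).factorial : ℂ)) * iteratedDeriv (k + 1) F z *
      coeffQ b e₂ e₃ p (k + 2) s := by
  have h1 : Finset.Icc 2 ((s : ℕ) + 2) = Finset.Ico 2 ((s : ℕ) + 3) := by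
    ext
    simp only [Finset.mem_Icc, Finset.mem_Ico]
    omega
  rw [h1, Finset.sum_Ico_eq_sum_range]
  have h2 : Finset.range ((s : ℕ) + 3 - 2) ⊆ Finset.range d := by
    refine Finset.range_subset_range.mpr ?_
    omega
  rw [← Finset.sum_subset h2]
  · refine Finset.sum_congr rfl fun k _ => ?_
    have e : 2 + k - 1 = k + 1 := by omega
    rw [e, add_comm 2 k]
    ring
  · intro k _ hk
    rw [Finset.mem_range, not_lt] at hk
    rw [hb.coeffQ_eq_zero p (by omega), mul_zero]

theorem IsCartanBasis.principalExtension_inl_zeta (hb : IsCartanBasis b w) (F : ℂ → ℂ) (u : Fin m)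
    (p : Fin 3 → ℝ) :
    principalExtension b w F (Sum.inl u) (zeta e₂ e₃ p) =
      F (functional b u (zeta e₂ e₃ p)) • b (Sum.inl u) +
      ∑ s : Fin d, if u = w s then (∑ k ∈ Finset.Icc 2 ((s : ℕ) + 2),
        ((1 / ((k - 1).factorial : ℂ)) * coeffQ b e₂ e₃ p k s *
          iteratedDeriv (k - 1) F (functional b u (zeta e₂ e₃ p))) • b (Sum.inr s)) else 0 := by
  rw [principalExtension_eq, add_comm]
  simp only [idemIndex, Sum.elim_inl, id, hb.nilPart_zeta_pow, mul_comm _ (b (Sum.inl u)),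
    Finset.mul_sum, mul_smul_comm, hb.idem_mul_nil, Finset.smul_sum, ← Finset.sum_smul,
    hb.sum_coeffQ]
  congr 1
  rw [Finset.sum_comm]
  refine Finset.sum_congr rfl fun s _ => ?_
  split_ifs
  · rw [Finset.sum_smul]
    exact Finset.sum_congr rfl fun k _ => smul_smul _ _ _
  · simp

theorem IsCartanBasis.principalExtension_inr_zeta (hb : IsCartanBasis b w) (F : ℂ → ℂ) (q : Fin d)
    (p : Fin 3 → ℝ) :
    principalExtension b w F (Sum.inr q) (zeta e₂ e₃ p) =
      F (functional b (w q) (zeta e₂ e₃ p)) • b (Sum.inr q) +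
      ∑ s : Fin d, ∑ k ∈ Finset.Icc 2 ((s : ℕ) + 2),
        ((1 / ((k - 1).factorial : ℂ)) * coeffQ b e₂ e₃ p k s *
          iteratedDeriv (k - 1) F (functional b (w q) (zeta e₂ e₃ p))) •
            (b (Sum.inr q) * b (Sum.inr s)) := by
  rw [principalExtension_eq, add_comm]
  simp only [idemIndex, Sum.elim_inr, hb.nilPart_zeta_pow, mul_comm _ (b (Sum.inr q)),
    Finset.mul_sum, mul_smul_comm, Finset.smul_sum, hb.sum_coeffQ, ← Finset.sum_smul]
  congr 1
  rw [Finset.sum_comm]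
  refine Finset.sum_congr rfl fun s _ => ?_
  rw [Finset.sum_smul]
  exact Finset.sum_congr rfl fun k _ => smul_smul _ _ _

end Zeta

/-! ### Decomposition of monogenic functions into principal extensions -/

section Decomposition

variable {A : Type*} [CommRing A] [Algebra ℂ A] {m d : ℕ}
  {b : Module.Basis (Fin m ⊕ Fin d) ℂ A} {w : Fin d → Fin m} {e₂ e₃ : A}
  {Ω : Set (Fin 3 → ℝ)}

/-- Monogenic functions of the variables of `ℝ³`, in terms of the coordinates of their values. -/
def CoordMonogenic (b : Module.Basis (Fin m ⊕ Fin d) ℂ A) (e₂ e₃ : A) (Ω : Set (Fin 3 → ℝ))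
    (Ψ : (Fin 3 → ℝ) → A) : Prop :=
  (∀ i, ContinuousOn (fun p => b.repr (Ψ p) i) Ω) ∧
    ∀ p ∈ Ω, ∃ Ψ' : A, ∀ v i,
      Tendsto (fun ε : ℝ => ε⁻¹ • (b.repr (Ψ (p + ε • v)) i - b.repr (Ψ p) i)) (𝓝[>] 0)
        (𝓝 (b.repr (zeta e₂ e₃ v * Ψ') i))

theorem CoordMonogenic.sub {Ψ₁ Ψ₂ : (Fin 3 → ℝ) → A} (h₁ : CoordMonogenic b e₂ e₃ Ω Ψ₁)
    (h₂ : CoordMonogenic b e₂ e₃ Ω Ψ₂) :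
    CoordMonogenic b e₂ e₃ Ω fun p => Ψ₁ p - Ψ₂ p := by
  refine ⟨fun i => ?_, fun p hp => ?_⟩
  · simp only [map_sub, Finsupp.sub_apply]
    exact (h₁.1 i).sub (h₂.1 i)
  · obtain ⟨a₁, ha₁⟩ := h₁.2 p hp
    obtain ⟨a₂, ha₂⟩ := h₂.2 p hp
    refine ⟨a₁ - a₂, fun v i => ?_⟩
    have e : b.repr (zeta e₂ e₃ v * (a₁ - a₂)) i =
        b.repr (zeta e₂ e₃ v * a₁) i - b.repr (zeta e₂ e₃ v * a₂) i := by
      rw [mul_sub, map_sub, Finsupp.sub_apply]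
    rw [e]
    refine ((ha₁ v i).sub (ha₂ v i)).congr fun ε => ?_
    simp only [map_sub, Finsupp.sub_apply, ← smul_sub]
    congr 1
    ring

theorem CoordMonogenic.sum {ι : Type*} {s : Finset ι} {Ψ : ι → (Fin 3 → ℝ) → A}
    (h : ∀ j ∈ s, CoordMonogenic b e₂ e₃ Ω (Ψ j)) :
    CoordMonogenic b e₂ e₃ Ω fun p => ∑ j ∈ s, Ψ j p := by
  refine ⟨fun i => ?_, fun p hp => ?_⟩
  · simp only [map_sum, Finsupp.finsetSum_apply]
    exact continuousOn_finsetSum _ fun j hj => (h j hj).1 i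
  · choose! a ha using fun j (hj : j ∈ s) => (h j hj).2 p hp
    refine ⟨∑ j ∈ s, a j, fun v i => ?_⟩
    have e : b.repr (zeta e₂ e₃ v * ∑ j ∈ s, a j) i =
        ∑ j ∈ s, b.repr (zeta e₂ e₃ v * a j) i := by
      rw [Finset.mul_sum, map_sum, Finsupp.finsetSum_apply]
    rw [e]
    refine (tendsto_finsetSum s fun j hj => ha j hj v i).congr fun ε => ?_
    simp only [map_sum, Finsupp.finsetSum_apply, ← Finset.smul_sum, ← Finset.sum_sub_distrib]

theorem IsMonogenic.coordMonogenic [TopologicalSpace A] [IsTopologicalAddGroup A]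
    [ContinuousSMul ℂ A] [T2Space A] (b : Module.Basis (Fin m ⊕ Fin d) ℂ A) {Φ : A → A}
    (h : IsMonogenic e₂ e₃ Ω Φ) :
    CoordMonogenic b e₂ e₃ Ω fun p => Φ (zeta e₂ e₃ p) := by
  have : FiniteDimensional ℂ A := Module.Finite.of_basis b
  have hcoord : ∀ i, Continuous fun a : A => b.repr a i := fun i =>
    LinearMap.continuous_of_finiteDimensional (b.coord i)
  have hzeta : Continuous (zeta e₂ e₃) := by
    have e : zeta e₂ e₃ = fun p => ((p 0 : ℝ) : ℂ) • (1 : A) + ((p 1 : ℝ) : ℂ) • e₂ +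
        ((p 2 : ℝ) : ℂ) • e₃ := by
      ext p
      simp only [zeta, Complex.coe_smul]
    rw [e]
    fun_prop
  refine ⟨fun i => (hcoord i).comp_continuousOn
    (h.1.comp hzeta.continuousOn fun p hp => mem_image_of_mem _ hp), fun p hp => ?_⟩
  obtain ⟨a, ha⟩ := h.2 _ (mem_image_of_mem (zeta e₂ e₃) hp)
  refine ⟨a, fun v i => ?_⟩
  refine (((hcoord i).tendsto _).comp (ha _ (mem_range_self v))).congr fun ε => ?_
  have hsmul : ∀ (r : ℝ) (x : A), b.repr (r • x) i = r • b.repr x i := fun r x => by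
    rw [← Complex.coe_smul, map_smul, Finsupp.smul_apply, Complex.coe_smul]
  simp only [Function.comp_apply, zeta_add_smul, hsmul, map_sub, Finsupp.sub_apply]

theorem IsCartanBasis.coordMonogenic_principalExtension (hb : IsCartanBasis b w)
    (hsurj : ∀ u : Fin m, functional b u '' E3 e₂ e₃ = Set.univ) (hΩ : IsOpen Ω) {F : ℂ → ℂ}
    (i : Fin m ⊕ Fin d)
    (hF : DifferentiableOn ℂ F (planeDomain b e₂ e₃ Ω (idemIndex w i))) :
    CoordMonogenic b e₂ e₃ Ω fun p => principalExtension b w F i (zeta e₂ e₃ p) := by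
  refine ⟨fun j => hb.continuousOn_principalExtension hsurj hΩ i hF (b.coord j), fun p hp => ?_⟩
  refine ⟨principalExtension b w (deriv F) i (zeta e₂ e₃ p), fun v j => ?_⟩
  have h := (hb.hasDerivAt_principalExtension (isOpen_planeDomain hsurj hΩ _) hF i
    (zeta e₂ e₃ v) (mem_planeDomain hp _) (b.coord j))
  have h' := (HasDerivAt.comp_ofReal (z := 0) (by simpa using h)).tendsto_slope_zero_right
  refine h'.congr fun ε => ?_
  simp [zeta_add_smul]

/-- A coordinate of a monogenic function whose derivatives are given by the multiplication by the
values of `f_u` is a holomorphic function of `f_u(ζ)`. -/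
theorem IsCartanBasis.exists_repr_eq (hb : IsCartanBasis b w)
    (hsurj : ∀ u : Fin m, functional b u '' E3 e₂ e₃ = Set.univ) (hΩ : IsOpen Ω)
    (hconv : ∀ u : Fin m, ConvexInDirection (lineL b e₂ e₃ u) Ω)
    {Ψ : (Fin 3 → ℝ) → A} (hΨ : CoordMonogenic b e₂ e₃ Ω Ψ) (i : Fin m ⊕ Fin d) (u : Fin m)
    (hmul : ∀ a : A, (∀ j, (∀ p ∈ Ω, b.repr (Ψ p) j = 0) → b.repr a j = 0) →
      ∀ h : A, b.repr (h * a) i = functional b u h * b.repr a i) :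
    ∃ F : ℂ → ℂ, DifferentiableOn ℂ F (planeDomain b e₂ e₃ Ω u) ∧
      ∀ p ∈ Ω, b.repr (Ψ p) i = F (functional b u (zeta e₂ e₃ p)) := by
  rw [planeDomain_eq]
  refine exists_differentiableOn_comp hΩ _ (coordFunctional_surjective hsurj u) ?_ (hΨ.1 i) ?_
  · intro p hp q hq hpq
    refine hconv u p hp q hq (hb.mem_lineL ?_)
    rw [map_sub, hpq, sub_self]
  · intro p hp
    obtain ⟨a, ha⟩ := hΨ.2 p hp
    refine ⟨b.repr a i, fun v => ?_⟩
    rw [coordFunctional_apply, ← hmul a]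
    · exact ha v i
    · intro j hj
      -- The derivative in the direction `e_1 = 1` is the element `a` itself, so coordinates in
      -- which `Ψ` vanishes identically vanish in `a` too.
      have hz : zeta e₂ e₃ (Pi.single 0 1) = 1 := by simp [zeta]
      have h1 := ha (Pi.single 0 1) j
      rw [hz, one_mul] at h1
      refine tendsto_nhds_unique h1 (tendsto_const_nhds.congr' ?_)
      have hcont : Tendsto (fun ε : ℝ => p + ε • (Pi.single 0 1 : Fin 3 → ℝ)) (𝓝[>] 0) (𝓝 p) := by
        have : Continuous fun ε : ℝ => p + ε • (Pi.single 0 1 : Fin 3 → ℝ) := by fun_prop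
        simpa using (this.tendsto 0).mono_left nhdsWithin_le_nhds
      filter_upwards [hcont (hΩ.mem_nhds hp)] with ε hε
      rw [hj _ hε, hj p hp, sub_self, smul_zero]

/-- Induction on the number `l` of remaining levels. Coordinate `k` is a holomorphic function `g` of
one `f_u(ζ)`, and subtracting the principal extension of `g` at that basis vector leaves a monogenic
function at level `k + 1`. -/
theorem IsCartanBasis.exists_nil_decomposition (hb : IsCartanBasis b w)
    (hsurj : ∀ u : Fin m, functional b u '' E3 e₂ e₃ = Set.univ) (hΩ : IsOpen Ω)
    (hconv : ∀ u : Fin m, ConvexInDirection (lineL b e₂ e₃ u) Ω) {k l : ℕ} (hkl : k + l = d)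
    {Ψ : (Fin 3 → ℝ) → A} (hΨ : CoordMonogenic b e₂ e₃ Ω Ψ)
    (hnil : ∀ p ∈ Ω, Ψ p ∈ nilFiltration b k) :
    ∃ G : Fin d → ℂ → ℂ, (∀ s, DifferentiableOn ℂ (G s) (planeDomain b e₂ e₃ Ω (w s))) ∧
      (∀ s : Fin d, (s : ℕ) < k → G s = fun _ => 0) ∧
      ∀ p ∈ Ω, Ψ p = ∑ s, principalExtension b w (G s) (Sum.inr s) (zeta e₂ e₃ p) := by
  induction l generalizing k Ψ with
  | zero =>
    obtain rfl : k = d := by omega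
    refine ⟨fun _ _ => 0, fun s => differentiableOn_const _, fun _ _ => rfl, fun p hp => ?_⟩
    simp only [principalExtension_zero, Finset.sum_const_zero]
    exact eq_zero_of_mem_nilFiltration (hnil p hp)
  | succ l ih =>
    let t : Fin d := ⟨k, by omega⟩
    obtain ⟨g, hg, hgt⟩ := hb.exists_repr_eq hsurj hΩ hconv hΨ (Sum.inr t) (w t) (by
      intro a ha h
      refine hb.repr_mul_inr (k := k) ⟨fun u => ?_, fun s hs => ?_⟩ h le_rfl
      · exact ha _ fun p hp => (hnil p hp).1 u
      · exact ha _ fun p hp => (hnil p hp).2 s hs)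
    have hgm := hb.coordMonogenic_principalExtension hsurj hΩ (Sum.inr t) hg
    have hΨ' : ∀ p ∈ Ω, Ψ p - principalExtension b w g (Sum.inr t) (zeta e₂ e₃ p) ∈
        nilFiltration b (k + 1) := by
      intro p hp
      have h1 := hb.principalExtension_inr_sub_mem g t (zeta e₂ e₃ p)
      have h2 : Ψ p - g (functional b (w t) (zeta e₂ e₃ p)) • b (Sum.inr t) ∈
          nilFiltration b (k + 1) := by
        rw [← hgt p hp]
        refine ⟨fun u => by simp [(hnil p hp).1 u], fun s hs => ?_⟩
        rcases Nat.lt_succ_iff_lt_or_eq.mp hs with hlt | heq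
        · have hne : t ≠ s := fun h => by
            rw [← h] at hlt
            exact lt_irrefl _ hlt
          simp [(hnil p hp).2 s hlt, hne]
        · obtain rfl : s = t := Fin.ext heq
          simp
      have := Submodule.sub_mem _ h2 h1
      rwa [sub_sub_sub_cancel_right] at this
    obtain ⟨G, hG, hG0, hGΨ⟩ := ih (by omega) (hΨ.sub hgm) hΨ'
    -- The clause that `G` vanishes below level `k + 1` makes slot `t` free, so overwriting it adds
    -- exactly the extension of `g`.
    refine ⟨Function.update G t g, fun s => ?_, fun s hs => ?_, fun p hp => ?_⟩
    · rcases eq_or_ne s t with rfl | h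
      · rwa [Function.update_self]
      · rw [Function.update_of_ne h]
        exact hG s
    · have h : s ≠ t := fun h => by
        rw [h] at hs
        exact lt_irrefl _ hs
      rw [Function.update_of_ne h]
      exact hG0 s (by omega)
    · have h1 := hGΨ p hp
      rw [sub_eq_iff_eq_add] at h1
      have h2 : ∀ s, principalExtension b w (Function.update G t g s) (Sum.inr s) (zeta e₂ e₃ p) =
          principalExtension b w (G s) (Sum.inr s) (zeta e₂ e₃ p) +
          if s = t then principalExtension b w g (Sum.inr t) (zeta e₂ e₃ p) else 0 := by
        intro s
        rcases eq_or_ne s t with rfl | h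
        · rw [Function.update_self, if_pos rfl, hG0 t (Nat.lt_succ_self k),
            principalExtension_zero, zero_add]
        · rw [Function.update_of_ne h, if_neg h, add_zero]
      rw [h1, Finset.sum_congr rfl fun s _ => h2 s, Finset.sum_add_distrib,
        Finset.sum_ite_eq' Finset.univ t, if_pos (Finset.mem_univ t)]

/-- A monogenic function is a sum of principal extensions of holomorphic functions. -/
theorem IsCartanBasis.exists_decomposition (hb : IsCartanBasis b w)
    (hsurj : ∀ u : Fin m, functional b u '' E3 e₂ e₃ = Set.univ) (hΩ : IsOpen Ω)
    (hconv : ∀ u : Fin m, ConvexInDirection (lineL b e₂ e₃ u) Ω)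
    {Ψ : (Fin 3 → ℝ) → A} (hΨ : CoordMonogenic b e₂ e₃ Ω Ψ) :
    ∃ (F : Fin m → ℂ → ℂ) (G : Fin d → ℂ → ℂ),
      (∀ u, DifferentiableOn ℂ (F u) (planeDomain b e₂ e₃ Ω u)) ∧
      (∀ s, DifferentiableOn ℂ (G s) (planeDomain b e₂ e₃ Ω (w s))) ∧
      ∀ p ∈ Ω, Ψ p = ∑ u, principalExtension b w (F u) (Sum.inl u) (zeta e₂ e₃ p) +
        ∑ s, principalExtension b w (G s) (Sum.inr s) (zeta e₂ e₃ p) := by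
  classical
  choose F hF hFΨ using fun u : Fin m =>
    hb.exists_repr_eq hsurj hΩ hconv hΨ (Sum.inl u) u fun a _ h => hb.functional_mul u h a
  have hFm : CoordMonogenic b e₂ e₃ Ω fun p =>
      ∑ u, principalExtension b w (F u) (Sum.inl u) (zeta e₂ e₃ p) :=
    CoordMonogenic.sum fun u _ => hb.coordMonogenic_principalExtension hsurj hΩ (Sum.inl u) (hF u)
  -- The extension of `F v` has `b (Sum.inl v)` as its only idempotent component, so the subtraction
  -- cancels all idempotent coordinates.
  obtain ⟨G, hG, -, hGΨ⟩ := hb.exists_nil_decomposition hsurj hΩ hconv (k := 0) (zero_add d)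
    (hΨ.sub hFm) (by
      intro p hp
      refine ⟨fun u => ?_, fun s hs => absurd hs (Nat.not_lt_zero _)⟩
      have h1 : ∀ v, b.repr (principalExtension b w (F v) (Sum.inl v) (zeta e₂ e₃ p))
          (Sum.inl u) = if v = u then F u (functional b u (zeta e₂ e₃ p)) else 0 := by
        intro v
        have := (hb.principalExtension_inl_sub_mem (F v) v (zeta e₂ e₃ p)).1 u
        rw [map_sub, Finsupp.sub_apply, sub_eq_zero] at this
        rw [this]
        rcases eq_or_ne v u with rfl | h
        · simp
        · simp [h]
      rw [map_sub, Finsupp.sub_apply, map_sum, Finsupp.finsetSum_apply, hFΨ u p hp,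
        Finset.sum_congr rfl fun v _ => h1 v, Finset.sum_ite_eq' Finset.univ u,
        if_pos (Finset.mem_univ u), sub_self])
  refine ⟨F, G, hF, hG, fun p hp => ?_⟩
  rw [← hGΨ p hp, add_sub_cancel]

end Decomposition

/-! ### The resolvent and the integral representation -/

section Resolvent

variable {A : Type*} [CommRing A] [Algebra ℂ A] {m d : ℕ}
  {b : Module.Basis (Fin m ⊕ Fin d) ℂ A} {w : Fin d → Fin m}

theorem IsCartanBasis.nilPart_pow_eq_zero (hb : IsCartanBasis b w) (a : A) :
    nilPart b a ^ (d + 1) = 0 :=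
  eq_zero_of_mem_nilFiltration (b := b) (hb.pow_succ_mem_nilFiltration (nilPart_mem a) d)

/-- The expansion of the resolvent. -/
theorem IsCartanBasis.inverse_smul_one_sub (hb : IsCartanBasis b w) (a : A) {t : ℂ}
    (ht : ∀ u, t ≠ functional b u a) :
    Ring.inverse (t • (1 : A) - a) = ∑ u, ∑ k ∈ Finset.range (d + 1),
      ((t - functional b u a) ^ (k + 1))⁻¹ • (nilPart b a ^ k * b (Sum.inl u)) := by
  set R : A := ∑ u, ∑ k ∈ Finset.range (d + 1),
    ((t - functional b u a) ^ (k + 1))⁻¹ • (nilPart b a ^ k * b (Sum.inl u)) with hR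
  have hmul : (t • (1 : A) - a) * R = 1 := by
    rw [hR, Finset.mul_sum]
    refine Eq.trans ?_ hb.sum_idem
    refine Finset.sum_congr rfl fun u _ => ?_
    have hne : t - functional b u a ≠ 0 := sub_ne_zero.mpr (ht u)
    -- Geometric series: the product telescopes from `f 0 = b (Sum.inl u)` to `f (d + 1)`, which
    -- vanishes with the nilpotent power.
    let f : ℕ → A := fun k =>
      ((t - functional b u a) ^ k)⁻¹ • (nilPart b a ^ k * b (Sum.inl u))
    have hterm : ∀ k, (t • (1 : A) - a) * (((t - functional b u a) ^ (k + 1))⁻¹ •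
        (nilPart b a ^ k * b (Sum.inl u))) = f k - f (k + 1) := by
      intro k
      have h1 : (t • (1 : A) - a) * b (Sum.inl u) =
          (t - functional b u a) • b (Sum.inl u) - nilPart b a * b (Sum.inl u) := by
        rw [sub_mul, hb.mul_basis a, smul_one_mul, sub_smul, sub_sub]
        rfl
      have h2 : (t • (1 : A) - a) * (nilPart b a ^ k * b (Sum.inl u)) =
          (t - functional b u a) • (nilPart b a ^ k * b (Sum.inl u)) -
            nilPart b a ^ (k + 1) * b (Sum.inl u) := by
        rw [mul_left_comm, h1, mul_sub, mul_smul_comm, pow_succ, mul_assoc]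
      rw [mul_smul_comm, h2, smul_sub, smul_smul]
      congr 2
      rw [pow_succ]
      field_simp
    rw [Finset.mul_sum, Finset.sum_congr rfl fun k _ => hterm k, Finset.sum_range_sub']
    simp [f, hb.nilPart_pow_eq_zero a]
  -- `Ring.inverse` is zero at non-units, so invertibility is needed to identify it with `R`.
  have hu : IsUnit (t • (1 : A) - a) := IsUnit.of_mul_eq_one _ hmul
  calc Ring.inverse (t • (1 : A) - a) = Ring.inverse (t • (1 : A) - a) *
        ((t • (1 : A) - a) * R) := by rw [hmul, mul_one]
    _ = R := by rw [← mul_assoc, Ring.inverse_mul_cancel _ hu, one_mul]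

/-- Reduces an algebra-valued integral to scalar ones, since the vectors do not depend on the
integration variable. -/
theorem hasContourIntegral_sum_smul [TopologicalSpace A] [IsTopologicalAddGroup A]
    [ContinuousSMul ℂ A] {γ : ℝ → ℂ} {ι : Type*} {s : Finset ι} {c : ι → ℂ → ℂ} {J : ι → ℂ}
    (v : ι → A) (hJ : ∀ i ∈ s, HasStieltjes γ (fun t => c i (γ t)) (J i)) {f : ℂ → A}
    (hf : ∀ z ∈ trace γ, f z = ∑ i ∈ s, c i z • v i) :
    HasContourIntegral γ f (∑ i ∈ s, J i • v i) := by
  refine (tendsto_finsetSum s fun i hi => (hJ i hi).smul_const (v i)).congr fun P => ?_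
  simp only [stieltjesSum, Finset.sum_smul]
  rw [Finset.sum_comm]
  refine Finset.sum_congr rfl fun k hk => ?_
  rw [hf _ (mem_trace (P.tag_mem (Finset.mem_range.mp hk))), Finset.smul_sum]
  exact Finset.sum_congr rfl fun i _ => mul_smul _ _ _

/-- The integral representation of principal extensions. -/
theorem IsCartanBasis.exists_hasContourIntegral [TopologicalSpace A] [IsTopologicalAddGroup A]
    [ContinuousSMul ℂ A] (hb : IsCartanBasis b w) (a : A) {D : Fin m → Set ℂ}
    (hD : ∀ u, IsOpen (D u)) {Γ : Fin m → ℝ → ℂ}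
    (hΓ : IsAdmissible D (fun q => functional b q a) Γ) (u : Fin m) {F : ℂ → ℂ}
    (hF : DifferentiableOn ℂ F (D u)) :
    ∃ J : A, HasContourIntegral (Γ u) (fun t => F t • Ring.inverse (t • (1 : A) - a)) J ∧
      ∀ i, idemIndex w i = u →
        b i * ((1 / (2 * Real.pi * Complex.I) : ℂ) • J) = principalExtension b w F i a := by
  have hJ := hΓ.jordan u
  have hne : ∀ z ∈ trace (Γ u), ∀ l, z ≠ functional b l a := by
    rintro z hz l rfl
    rcases eq_or_ne l u with rfl | h
    · exact (hΓ.surrounds l).1 hz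
    · exact hΓ.avoids u l h hz
  let c : Fin m × ℕ → ℂ → ℂ := fun x z => F z * ((z - functional b x.1 a) ^ (x.2 + 1))⁻¹
  -- Existence suffices for the terms with index `l ≠ u`, whose point `ξ_l` may lie on either side
  -- of `Γ u`: multiplication by `b i` removes them afterwards.
  have hex : ∀ x : Fin m × ℕ, ∃ I, HasStieltjes (Γ u) (fun t => c x (Γ u t)) I := by
    intro x
    refine exists_hasStieltjes hJ.continuousOn hJ.rectifiable (ContinuousOn.mul ?_ ?_)
    · exact hF.continuousOn.comp hJ.continuousOn fun t ht => hΓ.trace_subset u (mem_trace ht)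
    · refine ContinuousOn.inv₀ ((hJ.continuousOn.sub continuousOn_const).pow _) fun t ht => ?_
      exact pow_ne_zero _ (sub_ne_zero.mpr (hne _ (mem_trace ht) _))
  choose I hI using hex
  refine ⟨∑ x ∈ Finset.univ ×ˢ Finset.range (d + 1),
    I x • (nilPart b a ^ x.2 * b (Sum.inl x.1)), ?_, ?_⟩
  · refine hasContourIntegral_sum_smul _ (fun x _ => hI x) fun z hz => ?_
    rw [hb.inverse_smul_one_sub a (hne z hz), Finset.smul_sum, Finset.sum_product]
    refine Finset.sum_congr rfl fun l _ => ?_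
    rw [Finset.smul_sum]
    exact Finset.sum_congr rfl fun k _ => smul_smul _ _ _
  · rintro i rfl
    have hval : ∀ k, I (idemIndex w i, k) = 2 * Real.pi * Complex.I *
        (iteratedDeriv k F (functional b (idemIndex w i) a) / k.factorial) := fun k =>
      (hI (idemIndex w i, k)).unique (hasStieltjes_cauchy hJ.continuousOn hJ.rectifiable hJ.closed
        (hΓ.oriented _) (hD _) (hΓ.trace_subset _) (hΓ.inside_subset _) hF (hΓ.surrounds _) k)
    have hπ : (2 * Real.pi * Complex.I : ℂ) ≠ 0 := Complex.two_pi_I_ne_zero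
    rw [mul_smul_comm, Finset.mul_sum, Finset.sum_product_right, Finset.smul_sum,
      principalExtension]
    refine Finset.sum_congr rfl fun k _ => ?_
    have hterm : ∀ l, b i * (I (l, k) • (nilPart b a ^ k * b (Sum.inl l))) =
        if l = idemIndex w i then I (l, k) • (nilPart b a ^ k * b i) else 0 := by
      intro l
      rw [mul_smul_comm, mul_left_comm, mul_comm (b i), hb.idem_mul]
      split_ifs <;> simp
    rw [Finset.sum_congr rfl fun l _ => hterm l, Finset.sum_ite_eq', if_pos (Finset.mem_univ _),
      hval, smul_smul]
    congr 1
    field_simp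

end Resolvent

end MonogenicAlg

/-! ### The representation theorem -/

theorem theorem1 {A : Type*} [CommRing A] [Algebra ℂ A]
    [TopologicalSpace A] [IsTopologicalAddGroup A] [ContinuousSMul ℂ A] [T2Space A]
    {m d : ℕ} (b : Module.Basis (Fin m ⊕ Fin d) ℂ A) (w : Fin d → Fin m)
    (hb : IsCartanBasis b w)
    (e₂ e₃ : A) (he : LinearIndependent ℝ ![(1 : A), e₂, e₃])
    (hsurj : ∀ u : Fin m, functional b u '' E3 e₂ e₃ = Set.univ)
    (Ω : Set (Fin 3 → ℝ)) (hΩ_open : IsOpen Ω) (hΩ_conn : IsConnected Ω)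
    (hΩ_convex : ∀ u : Fin m, ConvexInDirection (lineL b e₂ e₃ u) Ω)
    (Φ : A → A) (hΦ : IsMonogenic e₂ e₃ Ω Φ) :
    ∃ (F : Fin m → ℂ → ℂ) (G : Fin d → ℂ → ℂ),
      (∀ u, DifferentiableOn ℂ (F u) (planeDomain b e₂ e₃ Ω u)) ∧
      (∀ s, DifferentiableOn ℂ (G s) (planeDomain b e₂ e₃ Ω (w s))) ∧
      -- admissible curves exist at every point, and
      -- the integral representation holds with any admissible curves
      (∀ ζ ∈ omegaZeta e₂ e₃ Ω,
        (∃ Γ : Fin m → ℝ → ℂ,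
          IsAdmissible (planeDomain b e₂ e₃ Ω) (fun q => functional b q ζ) Γ) ∧
        ∀ Γ : Fin m → ℝ → ℂ,
          IsAdmissible (planeDomain b e₂ e₃ Ω) (fun q => functional b q ζ) Γ →
          ∃ (J : Fin m → A) (K : Fin d → A),
            (∀ u, HasContourIntegral (Γ u)
              (fun t => F u t • Ring.inverse (t • (1 : A) - ζ)) (J u)) ∧
            (∀ s, HasContourIntegral (Γ (w s))
              (fun t => G s t • Ring.inverse (t • (1 : A) - ζ)) (K s)) ∧
            Φ ζ = ∑ u, b (Sum.inl u) * ((1 / (2 * Real.pi * Complex.I) : ℂ) • J u) +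
              ∑ s, b (Sum.inr s) * ((1 / (2 * Real.pi * Complex.I) : ℂ) • K s)) ∧
      -- the equivalent explicit form through the functions and their derivatives
      (∀ p ∈ Ω, ∀ ξ : Fin m → ℂ, (∀ u, ξ u = functional b u (zeta e₂ e₃ p)) →
        Φ (zeta e₂ e₃ p) =
          ∑ u, F u (ξ u) • b (Sum.inl u) +
          ∑ s : Fin d, ∑ k ∈ Finset.Icc 2 ((s : ℕ) + 2),
            ((1 / ((k - 1).factorial : ℂ)) * coeffQ b e₂ e₃ p k s *
              iteratedDeriv (k - 1) (F (w s)) (ξ (w s))) • b (Sum.inr s) +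
          ∑ q, G q (ξ (w q)) • b (Sum.inr q) +
          ∑ q : Fin d, ∑ s : Fin d, ∑ k ∈ Finset.Icc 2 ((s : ℕ) + 2),
            ((1 / ((k - 1).factorial : ℂ)) * coeffQ b e₂ e₃ p k s *
              iteratedDeriv (k - 1) (G q) (ξ (w q))) • (b (Sum.inr q) * b (Sum.inr s))) := by
  have hD := isOpen_planeDomain (b := b) (e₂ := e₂) (e₃ := e₃) hsurj hΩ_open
  obtain ⟨F, G, hF, hG, hdec⟩ :=
    hb.exists_decomposition hsurj hΩ_open hΩ_convex (hΦ.coordMonogenic b)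
  refine ⟨F, G, hF, hG, ?_, ?_⟩
  · rintro _ ⟨p, hp, rfl⟩
    refine ⟨exists_isAdmissible hD fun q => mem_planeDomain hp q, fun Γ hΓ => ?_⟩
    choose J hJ hJF using fun u => hb.exists_hasContourIntegral _ hD hΓ u (hF u)
    choose K hK hKG using fun s => hb.exists_hasContourIntegral _ hD hΓ (w s) (hG s)
    refine ⟨J, K, hJ, hK, ?_⟩
    rw [hdec p hp]
    congr 1
    · exact Finset.sum_congr rfl fun u _ => (hJF u (Sum.inl u) rfl).symm
    · exact Finset.sum_congr rfl fun s _ => (hKG s (Sum.inr s) rfl).symm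
  · intro p hp ξ hξ
    obtain rfl : ξ = fun u => functional b u (zeta e₂ e₃ p) := funext hξ
    rw [hdec p hp]
    simp only [hb.principalExtension_inl_zeta, hb.principalExtension_inr_zeta,
      Finset.sum_add_distrib]
    -- With the sum over the idempotent indices inside, each nilpotent index `s` selects the single
    -- term `u = w s`.
    rw [Finset.sum_comm (s := (Finset.univ : Finset (Fin m)))]
    simp only [Finset.sum_ite_eq', Finset.mem_univ, if_true, add_assoc]
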